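/- **Notation.** For $n\ge 1$ let $N=\{1,\dots,n\}$, and let $\Pi(n)$ be the set of partitions of $N$, ordered by refinement ($\pi\le\pi'$ if every block of $\pi$ is contained in a block of $\pi'$); $\pi^\bot$ is the partition into singletons, and $\pi^\bot_{jk}$ ($j\ne k$) is the partition whose blocks are $\{j,k\}$ and singletons. An *embedded subset* of $N$ is a pair $S\pi=(S,\pi)$ with $\pi\in\Pi(n)$ and $S\in\pi$ (so $S\ne\emptyset$). Let $\mathfrak C(n)$ be the set of embedded subsets, and $\mathfrak C(n)_\bot=\mathfrak C(n)\cup\{\bot\}$, ordered by $(S,\pi)\sqsubseteq(S',\pi')\iff S\subseteq S'$ and $\pi\le\pi'$, with $\bot$ below everything. The same notation ($\Pi(M)$, $\mathfrak C(M)$) is used for any finite nonempty ground set $M$. $S_{n,k}$ is the Stirling number of the second kind, and $|\mathcal C([x,y])|$ is the number of maximal chains of the interval $[x,y]$; $|\mathcal C(\mathfrak C(n)_\bot)|$ is the number of maximal chains from bottom to top. Sizes of blocks $S,T,S_i$ are denoted $s,t,s_i$. **Proposition.** For every $n>2$, $(\mathfrak C(n)_\bot,\sqsubseteq)$ is a lattice,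 with the following properties. 1. $(S,\pi)\vee(S',\pi')=(T\cup T',\rho)$, where $T,T'$ are the blocks of $\pi\vee\pi'$ containing $S$ and $S'$ respectively and $\rho$ is obtained from $\pi\vee\pi'$ by merging $T$ and $T'$; $(S,\pi)\wedge(S',\pi')=(S\cap S',\pi\wedge\pi')$ if $S\cap S'\neq\emptyset$, and $\bot$ otherwise. 2. The top and bottom elements are $N\{N\}$ and $\bot$. Every element has a complement; every embedded subset whose first component is $N\setminus S$ is a complement of $S\pi$. 3. If $\pi$ is a $k$-partition (has $k$ blocks), $S\pi$ is covered by exactly $\binom k2$ elements; if $k<n$, it covers exactly $\sum_{T\in\pi}2^{t-1}-|\pi|+2^{s-1}-1$ elements; if $k=n$, it covers only $\bot$. 4. The atoms are the $(\{i\},\pi^\bot)$, $i\in N$. The join-irreducible elements are the atoms and the $(\{i\},\pi^\bot_{jk})$ with $j\neq k$, $i\notin\{j,k\}$. The co-atoms, and also the meet-irreducible elements, are exactly the $(S,\pi)$ with $\pi$ a 2-partition. 5. The lattice satisfies the Jordan–Dedekind chain condition (all maximal chains of an interval have the same length; it is ranked), its height function is $h(S\pi)=n-k+1$ if $\pi$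 is a $k$-partition and $h(\bot)=0$, and the height of the lattice is $n$. 6. The lattice is not distributive, not upper locally distributive (for some $x$ the interval from $x$ to the join of the elements covering $x$ is not distributive), not lower locally distributive (the dual notion), not atomistic, not geometric, and not modular, but it is upper semimodular. 7. For $1\le k\le n$, the number of elements of height $n-k+1$ is $kS_{n,k}$. The total number of elements is $\sum_{k=1}^n kS_{n,k}+1$. 8. Let $S\pi$ be an embedded subset with $\pi=\{S,S_2,\dots,S_k\}$. Then $[(\{i\},\pi^\bot),N\{N\}]\cong\Pi(n)$ for each $i\in N$; $[\bot,S\pi]\cong\big(\mathfrak C(S)\times\Pi(S_2)\times\cdots\times\Pi(S_k)\big)\cup\{\bot\}$ (with $\bot$ an added bottom); and $[S\pi,N\{N\}]\cong[(\{i\},\pi^\bot),K\{K\}]_{\mathfrak C(k)_\bot}\cong\Pi(k)$ for each $i\in K=\{1,\dots,k\}$, with $\pi^\bot$ now the partition of $K$ into singletons. If $S'\pi'\sqsubseteq S\pi$ and $\pi'$ is a $k'$-partition whose blocks are labelled in any way by $1,\dots,k'$, then $[S'\pi',S\pi]\cong[(\{i\},\pi^\bot),Q]_{\mathfrak C(k')_\bot}$,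 where $i$ is the label of $S'$, $\pi^\bot$ is the partition of $\{1,\dots,k'\}$ into singletons, and $Q$ is the image of $S\pi$ in $\mathfrak C(k')$, in which each block of $\pi$ is replaced by the set of labels of the blocks of $\pi'$ that it contains. 9. The number of maximal chains from $\bot$ to $N\{N\}$ is $\frac{(n!)^2}{2^{n-1}}$, which is also the number of maximal chains of greatest length in $\mathfrak C(n)$. 10. If $\pi=\{S,S_2,\dots,S_k\}$, then $|\mathcal C([\bot,S\pi])|=\frac{s\,(n-k)!}{2^{n-k}}\,s!\,s_2!\cdots s_k!$ and $|\mathcal C([S\pi,N\{N\}])|=\frac1k|\mathcal C(\mathfrak C(k)_\bot)|=\frac{k!\,(k-1)!}{2^{k-1}}$. 11. If $S'\pi'\sqsubseteq S\pi$, where $\pi=\{S_1,\dots,S_k\}$, $\pi'$ is a $k'$-partition, and $l_i$ is the number of blocks of $\pi'$ contained in $S_i$, then $|\mathcal C([S'\pi',S\pi])|=\frac{(k'-k)!}{2^{k'-k}}\,l_1!\,l_2!\cdots l_k!$. Moreover, for $n=1,\dots,8$ the values of $|\mathfrak C(n)_\bot|$ are $2,4,11,38,152,675,3264,17008$, and those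 of $|\mathcal C(\mathfrak C(n)_\bot)|$ are $1,2,9,72,900,16200,396900,12700800$. -/

import Mathlib

/-- An embedded subset of the finite ground set `N`: a block `S` (automatically nonempty) together
with a partition `π` of `N` such that `S ∈ π`. -/
@[ext]
structure EmbeddedSubset {α : Type*} [DecidableEq α] (N : Finset α) where
  /-- the distinguished block `S` -/
  block : Finset α
  /-- the partition `π`; Mathlib orders `Finpartition N` by refinement -/
  part : Finpartition N
  /-- `S` is one of the blocks of `π` -/
  mem : block ∈ part.parts

namespace EmbeddedSubset

variable {α : Type*} [DecidableEq α] {N : Finset α}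

/-- The product order: `S ⊆ S'` and `π ≤ π'`. -/
instance : PartialOrder (EmbeddedSubset N) where
  le P Q := P.block ⊆ Q.block ∧ P.part ≤ Q.part
  le_refl P := ⟨subset_rfl, le_rfl⟩
  le_trans P Q R h k := ⟨h.1.trans k.1, h.2.trans k.2⟩
  le_antisymm P Q h k := EmbeddedSubset.ext (h.1.antisymm k.1) (h.2.antisymm k.2)

/-- The embedded subset `(i, π^⊥)`, where `π^⊥` is the partition of `N` into singletons. -/
def atom (i : α) (hi : i ∈ N) : EmbeddedSubset N where
  block := {i}
  part := ⊥
  mem := Finpartition.mem_bot_iff.2 ⟨i, hi, rfl⟩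

/-- The embedded subset `N{N}`. -/
def whole (hN : N.Nonempty) : EmbeddedSubset N where
  block := N
  part := Finpartition.indiscrete (Finset.nonempty_iff_ne_empty.1 hN)
  mem := by simp

theorem block_nonempty (P : EmbeddedSubset N) : P.block.Nonempty :=
  P.part.nonempty_of_mem_parts P.mem

theorem le_whole (hN : N.Nonempty) (P : EmbeddedSubset N) : P ≤ whole hN := by
  refine ⟨P.part.le P.mem, fun b hb => ⟨N, ?_, P.part.le hb⟩⟩
  simp [whole]

instance : Finite (EmbeddedSubset N) := by
  refine Finite.of_injective
    (fun P : EmbeddedSubset N =>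
      ((⟨P.block, Finset.mem_powerset.2 (P.part.le P.mem)⟩, P.part) : N.powerset × Finpartition N))
    fun P Q h => ?_
  simp only [Prod.mk.injEq, Subtype.mk.injEq] at h
  exact EmbeddedSubset.ext h.1 h.2

/-- `(S ∩ S', π ∧ π')` for embedded subsets with `S ∩ S' ≠ ∅`. -/
def inter (P Q : EmbeddedSubset N) (h : (P.block ∩ Q.block).Nonempty) : EmbeddedSubset N where
  block := P.block ∩ Q.block
  part := P.part ⊓ Q.part
  mem := by
    rw [Finpartition.parts_inf, Finset.mem_erase]
    exact ⟨Finset.nonempty_iff_ne_empty.1 h,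
      Finset.mem_image.2 ⟨(P.block, Q.block), Finset.mem_product.2 ⟨P.mem, Q.mem⟩, rfl⟩⟩

end EmbeddedSubset

/-- The embedded subsets of `N` with an added bottom element `⊥`, ordered by the product order. -/
abbrev EmbLattice {α : Type*} [DecidableEq α] (N : Finset α) : Type _ :=
  WithBot (EmbeddedSubset N)

namespace EmbLattice

variable {α : Type*} [DecidableEq α] {N : Finset α}

/-- The meet of two elements, with value `⊥` for embedded subsets that have disjoint blocks. -/
def meet : EmbLattice N → EmbLattice N → EmbLattice N
  | (P : EmbeddedSubset N), (Q : EmbeddedSubset N) =>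
    if h : (P.block ∩ Q.block).Nonempty then ((P.inter Q h : EmbeddedSubset N) : EmbLattice N) else ⊥
  | _, _ => ⊥

instance : SemilatticeInf (EmbLattice N) where
  inf := meet
  inf_le_left x y := by
    induction x using WithBot.recBotCoe with
    | bot => exact bot_le
    | coe P =>
      induction y using WithBot.recBotCoe with
      | bot => exact bot_le
      | coe Q =>
        change meet (P : EmbLattice N) Q ≤ P
        simp only [meet]
        split_ifs with h
        · exact WithBot.coe_le_coe.2 ⟨Finset.inter_subset_left, inf_le_left⟩
        · exact bot_le
  inf_le_right x y := by
    induction x using WithBot.recBotCoe with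
    | bot => exact bot_le
    | coe P =>
      induction y using WithBot.recBotCoe with
      | bot => exact bot_le
      | coe Q =>
        change meet (P : EmbLattice N) Q ≤ Q
        simp only [meet]
        split_ifs with h
        · exact WithBot.coe_le_coe.2 ⟨Finset.inter_subset_right, inf_le_right⟩
        · exact bot_le
  le_inf x y z hxy hxz := by
    induction x using WithBot.recBotCoe with
    | bot => exact bot_le
    | coe P =>
      induction y using WithBot.recBotCoe with
      | bot => exact absurd hxy (WithBot.not_coe_le_bot P)
      | coe Q =>
        induction z using WithBot.recBotCoe with
        | bot => exact absurd hxz (WithBot.not_coe_le_bot P)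
        | coe R =>
          have h1 := WithBot.coe_le_coe.1 hxy
          have h2 := WithBot.coe_le_coe.1 hxz
          have hs : P.block ⊆ Q.block ∩ R.block := Finset.subset_inter h1.1 h2.1
          change (P : EmbLattice N) ≤ meet (Q : EmbLattice N) R
          simp only [meet]
          rw [dif_pos (P.block_nonempty.mono hs)]
          exact WithBot.coe_le_coe.2 ⟨hs, le_inf h1.2 h2.2⟩

/-- The top element is `N{N}` (and `⊥` in the degenerate case `N = ∅`). -/
instance : OrderTop (EmbLattice N) where
  top := if h : N.Nonempty then ((EmbeddedSubset.whole h : EmbeddedSubset N) : EmbLattice N) else ⊥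
  le_top x := by
    induction x using WithBot.recBotCoe with
    | bot => exact bot_le
    | coe P =>
      have h : N.Nonempty := P.block_nonempty.mono (P.part.le P.mem)
      change (P : EmbLattice N) ≤ dite _ _ _
      rw [dif_pos h]
      exact WithBot.coe_le_coe.2 (P.le_whole h)

instance : BoundedOrder (EmbLattice N) where

instance : Finite (EmbLattice N) := inferInstanceAs (Finite (Option (EmbeddedSubset N)))

/-- The join is the meet of all upper bounds. -/
noncomputable instance : Lattice (EmbLattice N) where
  sup x y := (Set.toFinite (upperBounds {x, y})).toFinset.inf id
  le_sup_left x y := Finset.le_inf fun z hz =>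
    ((Set.Finite.mem_toFinset _).1 hz) (Set.mem_insert _ _)
  le_sup_right x y := Finset.le_inf fun z hz =>
    ((Set.Finite.mem_toFinset _).1 hz) (Set.mem_insert_of_mem _ rfl)
  sup_le x y z hx hy := Finset.inf_le (f := id) <| (Set.Finite.mem_toFinset _).2 <| by
    rintro w (rfl | rfl)
    · exact hx
    · exact hy

end EmbLattice

/-- `𝔠(n)`, the embedded subsets of an `n`-element set. -/
abbrev Emb (n : ℕ) : Type := EmbeddedSubset (Finset.univ : Finset (Fin n))

/-- `𝔠(n)_⊥`, the embedded subsets of an `n`-element set with an added bottom element. -/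
abbrev EmbBot (n : ℕ) : Type := EmbLattice (Finset.univ : Finset (Fin n))

/-- `Π(n)`, the partitions of an `n`-element set ordered by refinement. -/
abbrev SetPartition (n : ℕ) : Type := Finpartition (Finset.univ : Finset (Fin n))

/-- The element `(i, π^⊥)` of `𝔠(n)`. -/
abbrev Emb.atom {n : ℕ} (i : Fin n) : Emb n := EmbeddedSubset.atom i (Finset.mem_univ i)

/-- The number of maximal chains from `x` to `y`, i.e. of the interval `[x, y]` (a `Flag` is a
maximal chain). -/
noncomputable def numMaxChains {P : Type*} [PartialOrder P] (x y : P) : ℕ :=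
  Nat.card (Flag (Set.Icc x y))

/-- The Jordan-Dedekind chain condition: any two maximal chains of an interval have the same
length. -/
def JordanDedekind (P : Type*) [PartialOrder P] : Prop :=
  ∀ x y : P, x ≤ y → ∀ F G : Flag (Set.Icc x y),
    (F : Set (Set.Icc x y)).ncard = (G : Set (Set.Icc x y)).ncard

/-- The distributive law holds for all elements of the interval `[u, v]`. -/
def DistribOnIcc {L : Type*} [Lattice L] (u v : L) : Prop :=
  ∀ x ∈ Set.Icc u v, ∀ y ∈ Set.Icc u v, ∀ z ∈ Set.Icc u v, x ⊓ (y ⊔ z) = (x ⊓ y) ⊔ (x ⊓ z)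

/-- The lattice is distributive. -/
def IsDistribLattice (L : Type*) [Lattice L] : Prop :=
  ∀ x y z : L, x ⊓ (y ⊔ z) = (x ⊓ y) ⊔ (x ⊓ z)

/-- Upper locally distributive: for each `x`, the interval from `x` to the join of all elements
covering `x` is distributive. -/
def IsUpperLocallyDistrib (L : Type*) [Lattice L] : Prop :=
  ∀ x u : L, IsLUB (insert x {y | x ⋖ y}) u → DistribOnIcc x u

/-- Lower locally distributive: for each `x`, the interval from the meet of all elements covered
by `x` to `x` is distributive. -/
def IsLowerLocallyDistrib (L : Type*) [Lattice L] : Prop :=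
  ∀ x u : L, IsGLB (insert x {y | y ⋖ x}) u → DistribOnIcc u x

/-- A (finite) lattice is geometric if it is upper semimodular and atomistic. -/
def IsGeometricLattice (L : Type*) [Lattice L] [OrderBot L] : Prop :=
  Finite L ∧ IsUpperModularLattice L ∧ IsAtomistic L

/-! Everything rests on rigidity: if `Q` and `R` both lie above the same embedded subset `P`, then
`Q ≤ R` as soon as the partition of `Q` refines that of `R` (`EmbeddedSubset.le_of_part_le`),
because the distinguished block is the one containing any point of `P.block`. Hence the part of the
order above `P` is the set of partitions coarser than `P.part`. A cover between embedded subsets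
merges exactly two blocks (`exists_part_eq_merge`), so it lowers the number of blocks by one. With
the atoms sitting just above `⊥`, this makes `n - k + 1` a rank function, which yields the chain
condition and the height.

Joins are obtained by merging, in `π ∨ π'`, the blocks containing the two distinguished blocks. Two
elements with complementary distinguished blocks are therefore lattice complements, and since this
ignores the rest of the partitions, an atom and an element `({i}, π_jk)` above it share a
complement. That pentagon excludes distributivity and modularity. The local laws fail too, since the
atoms join to `⊤` and the co-atoms meet to `⊥`. Upper semimodularity survives because merging two
blocks of a meet forces at most one merge above.

Intervals above `P` are described by replacing each block by a label (`relabel`), and intervals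
below `P` by restricting partitions to each block of `P` (`below`), with `bind` as the inverse.

Maximal chains are counted by their second element (`numMaxChains_eq_sum`). Between `P' ≤ P`, let `l
T` be the number of blocks of `P'` inside the block `T` of `P`, and `d + 1` the number of merges
needed. A first merge inside `T` can be chosen in `l T * (l T - 1) / 2` ways and divides `∏ (l T)!`
by `l T`; the contributions are thus proportional to `l T - 1`, and these sum to `d + 1`. This is
the induction for `(d + 1)! / 2 ^ (d + 1) * ∏ (l T)!` (`numMaxChains_eq`), from which the other
chain counts follow.

Lower covers split a block in two; splitting the distinguished block also requires choosing a half,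
which doubles its contribution (`EmbeddedSubset.ncard_setOf_covBy`). The number of elements comes
from the Stirling recursion, in which adding a point to a block of a partition is the choice of an
embedded subset (`Finpartition.ncard_insert`). -/

/-! ### Maximal chains of intervals and rank functions -/

section MaximalChains

variable {P : Type*} [PartialOrder P]

/-- The maximal chains of the interval `[x, y]`, as sets of elements of `P`. -/
def maxChainsBetween (x y : P) : Set (Set P) :=
  {C | C ⊆ Set.Icc x y ∧ IsChain (· ≤ ·) C ∧
    ∀ w ∈ Set.Icc x y, (∀ c ∈ C, w ≤ c ∨ c ≤ w) → w ∈ C}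

theorem image_coe_mem_maxChainsBetween {x y : P} (F : Flag (Set.Icc x y)) :
    Subtype.val '' (F : Set (Set.Icc x y)) ∈ maxChainsBetween x y := by
  refine ⟨?_, ?_, ?_⟩
  · rintro _ ⟨c, -, rfl⟩
    exact c.2
  · rintro _ ⟨c, hc, rfl⟩ _ ⟨d, hd, rfl⟩ -
    exact F.le_or_le hc hd
  · intro w hw h
    refine ⟨⟨w, hw⟩, ?_, rfl⟩
    have h1 : IsChain (· ≤ ·) (insert (⟨w, hw⟩ : Set.Icc x y) (F : Set (Set.Icc x y))) :=
      F.chain_le.insert fun b hb _ => h b.1 ⟨b, hb, rfl⟩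
    have h2 := F.max_chain' h1 (Set.subset_insert _ _)
    exact h2.ge (Set.mem_insert _ _)

theorem numMaxChains_eq_ncard (x y : P) :
    numMaxChains x y = (maxChainsBetween x y).ncard := by
  rw [← Nat.card_coe_set_eq, numMaxChains]
  refine Nat.card_eq_of_bijective
    (fun F => (⟨_, image_coe_mem_maxChainsBetween F⟩ : maxChainsBetween x y)) ⟨?_, ?_⟩
  · intro F G h
    exact SetLike.coe_injective (Subtype.val_injective.image_injective (congrArg Subtype.val h))
  · rintro ⟨C, hC, hch, hmax⟩
    refine ⟨⟨Subtype.val ⁻¹' C, ?_, ?_⟩, ?_⟩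
    · intro a ha b hb hab
      exact hch ha hb fun h => hab (Subtype.ext h)
    · intro D hD hCD
      refine hCD.antisymm fun w hw => hmax w.1 w.2 fun c hc => ?_
      exact hD.total hw (hCD (show (⟨c, hC hc⟩ : Set.Icc x y) ∈ _ from hc))
    · refine Subtype.ext ?_
      change Subtype.val '' (Subtype.val ⁻¹' C) = C
      rw [Set.image_preimage_eq_iff]
      intro c hc
      exact ⟨⟨c, hC hc⟩, rfl⟩

theorem left_mem_of_mem_maxChainsBetween {x y : P} (hxy : x ≤ y) {C : Set P}
    (hC : C ∈ maxChainsBetween x y) : x ∈ C :=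
  hC.2.2 x ⟨le_rfl, hxy⟩ fun _ hc => Or.inl (hC.1 hc).1

theorem right_mem_of_mem_maxChainsBetween {x y : P} (hxy : x ≤ y) {C : Set P}
    (hC : C ∈ maxChainsBetween x y) : y ∈ C :=
  hC.2.2 y ⟨hxy, le_rfl⟩ fun _ hc => Or.inr (hC.1 hc).2

theorem maxChainsBetween_self (x : P) : maxChainsBetween x x = {{x}} := by
  ext C
  constructor
  · intro hC
    have h1 := hC.1
    rw [Set.Icc_self] at h1
    exact h1.antisymm (Set.singleton_subset_iff.2 (left_mem_of_mem_maxChainsBetween le_rfl hC))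
  · rintro rfl
    refine ⟨by simp, IsChain.singleton, fun w hw _ => ?_⟩
    rwa [Set.Icc_self] at hw

theorem numMaxChains_self (x : P) : numMaxChains x x = 1 := by
  rw [numMaxChains_eq_ncard, maxChainsBetween_self, Set.ncard_singleton]

theorem insert_mem_maxChainsBetween {x y z : P} (hxz : x ⋖ z) (hzy : z ≤ y) {C : Set P}
    (hC : C ∈ maxChainsBetween z y) : insert x C ∈ maxChainsBetween x y := by
  refine ⟨?_, ?_, ?_⟩
  · refine Set.insert_subset ⟨le_rfl, hxz.le.trans hzy⟩ fun c hc => ?_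
    exact ⟨hxz.le.trans (hC.1 hc).1, (hC.1 hc).2⟩
  · exact hC.2.1.insert fun b hb _ => Or.inl (hxz.le.trans (hC.1 hb).1)
  · intro w hw h
    have hz := left_mem_of_mem_maxChainsBetween hzy hC
    rcases h z (Set.mem_insert_of_mem _ hz) with h1 | h1
    · rcases hxz.eq_or_eq hw.1 h1 with rfl | rfl
      · exact Set.mem_insert _ _
      · exact Set.mem_insert_of_mem _ hz
    · exact Set.mem_insert_of_mem _
        (hC.2.2 w ⟨h1, hw.2⟩ fun c hc => h c (Set.mem_insert_of_mem _ hc))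

/-- The second element `z` is a minimal element of `C \ {x}`, which is its least element because `C`
is a chain. Anything strictly between `x` and `z` would be comparable with all of `C`, hence in `C`
by maximality; so `z` covers `x`. -/
theorem exists_insert_of_mem_maxChainsBetween [Finite P] {x y : P} (hxy : x < y) {C : Set P}
    (hC : C ∈ maxChainsBetween x y) :
    ∃ z, x ⋖ z ∧ z ≤ y ∧ ∃ D ∈ maxChainsBetween z y, insert x D = C := by
  have hx := left_mem_of_mem_maxChainsBetween hxy.le hC
  have hy := right_mem_of_mem_maxChainsBetween hxy.le hC
  obtain ⟨z, ⟨hzC, hzx⟩, hz⟩ := (Set.toFinite (C \ {x})).exists_minimal ⟨y, hy, hxy.ne'⟩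
  have hleast : ∀ c ∈ C, c ≠ x → z ≤ c := fun c hc hcx =>
    (hC.2.1.total hzC hc).elim id fun h => hz ⟨hc, hcx⟩ h
  have hxz : x < z := lt_of_le_of_ne (hC.1 hzC).1 (Ne.symm hzx)
  refine ⟨z, ⟨hxz, fun w hxw hwz => ?_⟩, (hC.1 hzC).2, C \ {x}, ⟨?_, ?_, ?_⟩, ?_⟩
  · have hw : w ∈ C := by
      refine hC.2.2 w ⟨hxw.le, hwz.le.trans (hC.1 hzC).2⟩ fun c hc => ?_
      by_cases hcx : c = x
      · exact Or.inr (hcx ▸ hxw.le)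
      · exact Or.inl (hwz.le.trans (hleast c hc hcx))
    exact absurd (hleast w hw hxw.ne') hwz.not_ge
  · exact fun c hc => ⟨hleast c hc.1 hc.2, (hC.1 hc.1).2⟩
  · exact hC.2.1.mono Set.sdiff_subset
  · intro w hw h
    refine ⟨hC.2.2 w ⟨hxz.le.trans hw.1, hw.2⟩ fun c hc => ?_, (hxz.trans_le hw.1).ne'⟩
    by_cases hcx : c = x
    · exact Or.inr (hcx ▸ hxz.le.trans hw.1)
    · exact h c ⟨hc, hcx⟩
  · rw [Set.insert_sdiff_singleton, Set.insert_eq_of_mem hx]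

/-- The maximal chains of `[x, y]` with `x < y` are counted according to their second element. -/
theorem numMaxChains_eq_sum [Finite P] {x y : P} (hxy : x < y) (s : Finset P)
    (hs : ∀ z, z ∈ s ↔ x ⋖ z ∧ z ≤ y) :
    numMaxChains x y = ∑ z ∈ s, numMaxChains z y := by
  classical
  have hnot : ∀ z ∈ s, ∀ C ∈ maxChainsBetween z y, x ∉ C := fun z hz C hC hx =>
    ((hs z).1 hz).1.lt.not_ge (hC.1 hx).1
  have key : (Set.toFinite (maxChainsBetween x y)).toFinset =
      s.biUnion fun z => (Set.toFinite (maxChainsBetween z y)).toFinset.image (insert x) := by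
    ext C
    simp only [Set.Finite.mem_toFinset, Finset.mem_biUnion, Finset.mem_image]
    constructor
    · intro hC
      obtain ⟨z, h1, h2, D, hD, rfl⟩ := exists_insert_of_mem_maxChainsBetween hxy hC
      exact ⟨z, (hs z).2 ⟨h1, h2⟩, D, hD, rfl⟩
    · rintro ⟨z, hz, D, hD, rfl⟩
      exact insert_mem_maxChainsBetween ((hs z).1 hz).1 ((hs z).1 hz).2 hD
  have hinj : ∀ z ∈ s, ∀ z' ∈ s, ∀ C ∈ maxChainsBetween z y, ∀ D ∈ maxChainsBetween z' y,
      insert x C = insert x D → C = D := by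
    intro z hz z' hz' C hC D hD h
    have := congrArg (· \ {x}) h
    simpa [Set.insert_sdiff_of_mem, hnot z hz C hC, hnot z' hz' D hD] using this
  rw [numMaxChains_eq_ncard, Set.ncard_eq_toFinset_card _ (Set.toFinite _), key,
    Finset.card_biUnion]
  · refine Finset.sum_congr rfl fun z hz => ?_
    rw [Finset.card_image_of_injOn, numMaxChains_eq_ncard,
      Set.ncard_eq_toFinset_card _ (Set.toFinite _)]
    intro C hC D hD h
    simp only [Set.Finite.coe_toFinset] at hC hD
    exact hinj z hz z hz C hC D hD h
  · intro z hz z' hz' hne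
    rw [Function.onFun, Finset.disjoint_left]
    simp only [Finset.mem_image, Set.Finite.mem_toFinset]
    rintro _ ⟨C, hC, rfl⟩ ⟨D, hD, h⟩
    obtain rfl := hinj z' hz' z hz D hD C hC h
    -- A tail determines its starting point, which is its least element.
    refine hne (le_antisymm ?_ ?_)
    · exact (hC.1 (left_mem_of_mem_maxChainsBetween ((hs z').1 hz').2 hD)).1
    · exact (hD.1 (left_mem_of_mem_maxChainsBetween ((hs z).1 hz).2 hC)).1

/-- Each removal of the least element climbs one cover, which raises `r` by one. The equation is
written additively to avoid truncated subtraction. -/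
theorem ncard_of_mem_maxChainsBetween [Finite P] (r : P → ℕ)
    (hr : ∀ x y : P, x ⋖ y → r y = r x + 1) (y : P) :
    ∀ x ≤ y, ∀ C ∈ maxChainsBetween x y, C.ncard + r x = r y + 1 := by
  intro x
  induction x using (wellFounded_gt (α := P)).induction with
  | _ x ih =>
    intro hxy C hC
    rcases hxy.eq_or_lt with rfl | hlt
    · rw [maxChainsBetween_self] at hC
      rw [Set.mem_singleton_iff.1 hC, Set.ncard_singleton, add_comm]
    · obtain ⟨z, h1, h2, D, hD, rfl⟩ := exists_insert_of_mem_maxChainsBetween hlt hC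
      have h3 := ih z h1.lt h2 D hD
      have h4 := hr x z h1
      have h5 : x ∉ D := fun hx => h1.lt.not_ge (hD.1 hx).1
      rw [Set.ncard_insert_of_notMem h5 (Set.toFinite _)]
      omega

theorem ncard_flag_Icc [Finite P] (r : P → ℕ) (hr : ∀ x y : P, x ⋖ y → r y = r x + 1)
    {x y : P} (hxy : x ≤ y) (F : Flag (Set.Icc x y)) :
    (F : Set (Set.Icc x y)).ncard + r x = r y + 1 := by
  rw [← ncard_of_mem_maxChainsBetween r hr y x hxy _ (image_coe_mem_maxChainsBetween F),
    Set.ncard_image_of_injective _ Subtype.val_injective]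

theorem JordanDedekind.of_rank [Finite P] (r : P → ℕ)
    (hr : ∀ x y : P, x ⋖ y → r y = r x + 1) : JordanDedekind P := fun x y hxy F G => by
  have hF := ncard_flag_Icc r hr hxy F
  have hG := ncard_flag_Icc r hr hxy G
  omega

/-- Strict monotonicity bounds the height above by `r`; descending through lower covers to `⊥` gives
the other inequality. -/
theorem Order.height_eq_of_rank [Finite P] [OrderBot P] (r : P → ℕ) (h0 : r ⊥ = 0)
    (hmono : StrictMono r) (hr : ∀ x y : P, x ⋖ y → r y = r x + 1) (x : P) :
    Order.height x = r x := by
  refine le_antisymm ?_ ?_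
  · simpa using Order.height_le_height_apply_of_strictMono r hmono x
  · induction x using (wellFounded_lt (α := P)).induction with
    | _ x ih =>
      by_cases hx : x = ⊥
      · simp [hx, h0]
      · obtain ⟨y, -, hy⟩ := exists_le_covBy_of_lt (bot_lt_iff_ne_bot.2 hx)
        rw [hr y x hy, Nat.cast_add, Nat.cast_one]
        exact (add_le_add_left (ih y hy.lt) 1).trans (Order.height_add_one_le hy.lt)

end MaximalChains

/-! ### Adjoining a bottom element -/

section WithBot

variable {X : Type*} [PartialOrder X]

theorem isChain_insert_bot (F : Flag X) :
    IsChain (· ≤ ·) (insert (⊥ : WithBot X) ((↑) '' (F : Set X))) := by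
  refine IsChain.insert ?_ fun _ _ _ => Or.inl bot_le
  rintro _ ⟨a, ha, rfl⟩ _ ⟨b, hb, rfl⟩ -
  simpa using F.le_or_le ha hb

/-- Adding the bottom element to a maximal chain. -/
def Flag.withBot (F : Flag X) : Flag (WithBot X) where
  carrier := insert (⊥ : WithBot X) ((↑) '' (F : Set X))
  Chain' := isChain_insert_bot F
  max_chain' := by
    intro D hD h
    refine h.antisymm fun w hw => ?_
    induction w using WithBot.recBotCoe with
    | bot => exact Set.mem_insert _ _
    | coe a =>
      refine Set.mem_insert_of_mem _ ⟨a, ?_, rfl⟩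
      have h1 : IsChain (· ≤ ·) (insert a (F : Set X)) := F.chain_le.insert fun b hb _ => by
        simpa using hD.total hw (h (Set.mem_insert_of_mem _ ⟨b, hb, rfl⟩))
      exact (F.max_chain' h1 (Set.subset_insert _ _)).ge (Set.mem_insert _ _)

theorem Flag.coe_withBot (F : Flag X) :
    (F.withBot : Set (WithBot X)) = insert ⊥ ((↑) '' (F : Set X)) := rfl

/-- Every maximal chain of `WithBot X` contains `⊥`, so deleting `⊥` inverts `Flag.withBot`. -/
theorem card_flag_withBot : Nat.card (Flag (WithBot X)) = Nat.card (Flag X) := by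
  symm
  refine Nat.card_eq_of_bijective Flag.withBot ⟨?_, ?_⟩
  · intro F G h
    have h1 : insert (⊥ : WithBot X) ((↑) '' (F : Set X)) = insert ⊥ ((↑) '' (G : Set X)) :=
      congrArg Flag.carrier h
    refine SetLike.coe_injective (Set.ext fun a => ?_)
    have := Set.ext_iff.1 h1 (a : WithBot X)
    simpa using this
  · intro G
    refine ⟨⟨(↑) ⁻¹' (G : Set (WithBot X)), ?_, ?_⟩, ?_⟩
    · intro a ha b hb _
      simpa using G.le_or_le ha hb
    · intro D hD h
      refine h.antisymm fun a ha => ?_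
      have h1 : IsChain (· ≤ ·) (insert (a : WithBot X) (G : Set (WithBot X))) := by
        refine G.chain_le.insert fun b hb _ => ?_
        induction b using WithBot.recBotCoe with
        | bot => exact Or.inr bot_le
        | coe b => simpa using hD.total ha (h hb)
      exact (G.max_chain' h1 (Set.subset_insert _ _)).ge (Set.mem_insert _ _)
    · refine SetLike.coe_injective (Set.ext fun w => ?_)
      change w ∈ insert (⊥ : WithBot X)
        ((fun a : X => (a : WithBot X)) '' ((↑) ⁻¹' (G : Set (WithBot X)))) ↔ w ∈ G
      induction w using WithBot.recBotCoe with
      | bot => simp [G.bot_mem]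
      | coe a => simp

theorem nonempty_orderIso_of_surjective {A B : Type*} [PartialOrder A] [PartialOrder B]
    (f : A → B) (hf : ∀ u v, f u ≤ f v ↔ u ≤ v) (hs : Function.Surjective f) :
    Nonempty (A ≃o B) :=
  ⟨RelIso.ofSurjective (OrderEmbedding.ofMapLEIff f hf) hs⟩

/-- The elements of `X` below `a`, with a bottom element added, form the interval `[⊥, a]`. -/
theorem WithBot.nonempty_Icc_bot_orderIso (a : X) :
    Nonempty (Set.Icc (⊥ : WithBot X) a ≃o WithBot (Set.Iic a)) := by
  let f : WithBot (Set.Iic a) → Set.Icc (⊥ : WithBot X) a := fun w =>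
    ⟨w.map Subtype.val, bot_le, by
      induction w using WithBot.recBotCoe with
      | bot => exact bot_le
      | coe x => exact WithBot.coe_le_coe.2 x.2⟩
  obtain ⟨e⟩ := nonempty_orderIso_of_surjective f
    (fun u v => WithBot.map_le_iff (Subtype.val : Set.Iic a → X) Iff.rfl) (by
      rintro ⟨w, -, hw⟩
      induction w using WithBot.recBotCoe with
      | bot => exact ⟨⊥, rfl⟩
      | coe x => exact ⟨((⟨x, WithBot.coe_le_coe.1 hw⟩ : Set.Iic a) : WithBot _), rfl⟩)
  exact ⟨e.symm⟩

/-- An interval of `WithBot X` between elements of `X` is an interval of `X`. -/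
theorem WithBot.nonempty_Icc_coe_orderIso (a b : X) :
    Nonempty (Set.Icc (a : WithBot X) b ≃o Set.Icc a b) := by
  obtain ⟨e⟩ := nonempty_orderIso_of_surjective
    (fun x : Set.Icc a b => (⟨x.1, WithBot.coe_le_coe.2 x.2.1, WithBot.coe_le_coe.2 x.2.2⟩ :
      Set.Icc (a : WithBot X) b)) (fun u v => WithBot.coe_le_coe) (by
      rintro ⟨w, hw, hw'⟩
      induction w using WithBot.recBotCoe with
      | bot => exact absurd hw (WithBot.not_coe_le_bot a)
      | coe x => exact ⟨⟨x, WithBot.coe_le_coe.1 hw, WithBot.coe_le_coe.1 hw'⟩, rfl⟩)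
  exact ⟨e.symm⟩

/-- The maximal chains of `X` correspond to those of `WithBot X`. -/
theorem card_flag_eq_numMaxChains [OrderTop (WithBot X)] :
    Nat.card (Flag X) = numMaxChains (⊥ : WithBot X) ⊤ := by
  rw [← card_flag_withBot, numMaxChains]
  obtain ⟨e⟩ := nonempty_orderIso_of_surjective
    (fun x : WithBot X => (⟨x, bot_le, le_top⟩ : Set.Icc (⊥ : WithBot X) ⊤))
    (fun u v => Iff.rfl) (fun x => ⟨x.1, rfl⟩)
  exact Nat.card_congr (Flag.map e)

theorem Flag.coe_mem_maxChainsBetween {P : Type*} [PartialOrder P] [OrderBot P] [OrderTop P]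
    (F : Flag P) : (F : Set P) ∈ maxChainsBetween ⊥ ⊤ := by
  refine ⟨fun _ _ => ⟨bot_le, le_top⟩, F.chain_le, fun w _ h => ?_⟩
  exact (F.max_chain' (F.chain_le.insert fun b hb _ => h b hb) (Set.subset_insert _ _)).ge
    (Set.mem_insert _ _)

/-- The adjoined `⊥` absorbs the extra one in `ncard_of_mem_maxChainsBetween`. In particular all
maximal chains of `X` have the same length. -/
theorem Flag.ncard_add_one [Finite X] [OrderTop (WithBot X)] (r : WithBot X → ℕ)
    (hr : ∀ x y, x ⋖ y → r y = r x + 1) (F : Flag X) :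
    (F : Set X).ncard + r ⊥ = r ⊤ := by
  have h1 := ncard_of_mem_maxChainsBetween r hr ⊤ ⊥ bot_le _ F.withBot.coe_mem_maxChainsBetween
  rw [Flag.coe_withBot, Set.ncard_insert_of_notMem (by simp) (Set.toFinite _),
    Set.ncard_image_of_injective _ WithBot.coe_injective] at h1
  omega

end WithBot

/-! ### Irreducibles of a finite lattice through its covers -/

section Irreducible

variable {L : Type*} [Lattice L] [Finite L]

/-- Two distinct lower covers join to `x`. Conversely, by finiteness everything strictly below `x`
lies below a lower cover, so a unique lower cover bounds every join of elements strictly below `x`.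
-/
theorem supIrred_iff_ncard_covBy_eq_one {x : L} : SupIrred x ↔ {y | y ⋖ x}.ncard = 1 := by
  rw [Set.ncard_eq_one]
  constructor
  · intro h
    obtain ⟨b, hb⟩ := not_isMin_iff.1 h.1
    obtain ⟨c, -, hc⟩ := exists_le_covBy_of_lt hb
    refine ⟨c, Set.eq_singleton_iff_unique_mem.2 ⟨hc, fun d hd => ?_⟩⟩
    by_contra hne
    have h1 : c < c ⊔ d := lt_of_le_of_ne le_sup_left fun h1 => by
      have h2 : d ≤ c := h1 ▸ le_sup_right
      exact hd.2 (lt_of_le_of_ne h2 hne) hc.lt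
    have h2 : c ⊔ d = x := (hc.eq_or_eq h1.le (sup_le hc.le hd.le)).resolve_left h1.ne'
    rcases h.2 h2 with h3 | h3
    · exact hc.lt.ne h3
    · exact hd.lt.ne h3
  · rintro ⟨c, hc⟩
    have hcx : c ⋖ x := hc.ge rfl
    have hle : ∀ b < x, b ≤ c := fun b hb => by
      obtain ⟨d, hbd, hd⟩ := exists_le_covBy_of_lt hb
      exact hbd.trans (hc.le hd : d = c).le
    refine ⟨not_isMin_iff.2 ⟨c, hcx.lt⟩, fun a b hab => ?_⟩
    by_contra! h
    have ha : a < x := lt_of_le_of_ne (hab ▸ le_sup_left) h.1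
    have hb : b < x := lt_of_le_of_ne (hab ▸ le_sup_right) h.2
    exact hcx.lt.not_ge (hab ▸ sup_le (hle a ha) (hle b hb))

theorem infIrred_iff_ncard_covBy_eq_one {x : L} : InfIrred x ↔ {y | x ⋖ y}.ncard = 1 := by
  rw [← supIrred_toDual, supIrred_iff_ncard_covBy_eq_one]
  have : {y : Lᵒᵈ | y ⋖ OrderDual.toDual x} = OrderDual.toDual '' {y | x ⋖ y} := by
    ext y
    constructor
    · intro h
      exact ⟨OrderDual.ofDual y, h.ofDual, rfl⟩
    · rintro ⟨z, hz, rfl⟩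
      exact CovBy.toDual hz
  rw [this, Set.ncard_image_of_injective _ OrderDual.toDual.injective]

end Irreducible

/-! ### Merging and splitting blocks of a partition -/

namespace Finpartition

variable {α : Type*} [DecidableEq α] {N : Finset α}

/-- One common point suffices to identify the block of the coarser partition that contains `A`. -/
theorem subset_of_le_of_mem {π σ : Finpartition N} (h : π ≤ σ) {A C : Finset α} {x : α}
    (hA : A ∈ π.parts) (hC : C ∈ σ.parts) (hxA : x ∈ A) (hxC : x ∈ C) : A ⊆ C := by
  obtain ⟨D, hD, hAD⟩ := h hA
  rwa [σ.eq_of_mem_parts hC hD hxC (hAD hxA)]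

theorem ext_of_subset {π σ : Finpartition N} (h : π.parts ⊆ σ.parts) : π = σ := by
  refine Finpartition.ext (h.antisymm fun B hB => ?_)
  obtain ⟨x, hx⟩ := σ.nonempty_of_mem_parts hB
  obtain ⟨C, hC, hxC⟩ := π.exists_mem (σ.le hB hx)
  rwa [σ.eq_of_mem_parts hB (h hC) hx hxC]

/-- Sending a block of `π` to the block of `σ` containing it is surjective; the cardinality bound
makes it injective, so each block of `σ` contains only one block of `π` and equals it. -/
theorem eq_of_le_of_card_le {π σ : Finpartition N} (h : π ≤ σ)
    (hcard : π.parts.card ≤ σ.parts.card) : π = σ := by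
  classical
  refine le_antisymm h ?_
  have hch : ∀ B ∈ π.parts, ∃ C ∈ σ.parts, B ⊆ C := fun B hB => h hB
  choose! f hf hBf using hch
  have hsurj : Set.SurjOn f π.parts σ.parts := by
    intro C hC
    obtain ⟨B, hB, hBC⟩ := exists_le_of_le h hC
    obtain ⟨x, hx⟩ := π.nonempty_of_mem_parts hB
    exact ⟨B, hB, σ.eq_of_mem_parts (hf B hB) hC (hBf B hB hx) (hBC hx)⟩
  have hinj := Finset.injOn_of_surjOn_of_card_le f hf hsurj hcard
  intro C hC
  obtain ⟨B, hB, rfl⟩ := hsurj hC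
  refine ⟨B, hB, fun y hy => ?_⟩
  obtain ⟨D, hD, hyD⟩ := π.exists_mem (σ.le hC hy)
  have : f D = f B := σ.eq_of_mem_parts (hf D hD) hC (hBf D hD hyD) hy
  rwa [← hinj hD hB this]

theorem card_lt_of_lt {π σ : Finpartition N} (h : π < σ) : σ.parts.card < π.parts.card :=
  lt_of_not_ge fun hc => h.ne (eq_of_le_of_card_le h.le hc)

/-- The partition obtained from `π` by merging two blocks (and `π` itself if they are equal). -/
def merge (π : Finpartition N) {A B : Finset α} (hA : A ∈ π.parts) (hB : B ∈ π.parts) :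
    Finpartition N :=
  ofExistsUnique (insert (A ∪ B) ((π.parts.erase A).erase B))
    (by
      intro p hp
      rcases Finset.mem_insert.1 hp with rfl | hp
      · exact Finset.union_subset (π.le hA) (π.le hB)
      · exact π.le (Finset.mem_of_mem_erase (Finset.mem_of_mem_erase hp)))
    (by
      intro x hx
      obtain ⟨C, hC, hxC⟩ := π.exists_mem hx
      have key : ∀ D ∈ π.parts, x ∈ D → D = C := fun D hD hxD => π.eq_of_mem_parts hD hC hxD hxC
      by_cases h : C = A ∨ C = B
      · refine ⟨A ∪ B, ⟨Finset.mem_insert_self _ _, ?_⟩, ?_⟩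
        · rcases h with rfl | rfl <;> simp [hxC]
        · rintro D ⟨hD, hxD⟩
          grind
      · refine ⟨C, ⟨by grind, hxC⟩, ?_⟩
        rintro D ⟨hD, hxD⟩
        grind)
    (by
      have := π.empty_notMem_parts
      have := π.ne_empty hA
      grind)

section Merge

variable {π : Finpartition N} {A B : Finset α} (hA : A ∈ π.parts) (hB : B ∈ π.parts)

@[simp]
theorem merge_parts :
    (π.merge hA hB).parts = insert (A ∪ B) ((π.parts.erase A).erase B) := rfl

theorem union_mem_merge : A ∪ B ∈ (π.merge hA hB).parts := by simp

theorem le_merge : π ≤ π.merge hA hB := by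
  intro C hC
  by_cases h : C = A ∨ C = B
  · exact ⟨A ∪ B, union_mem_merge hA hB, by rcases h with rfl | rfl <;> simp⟩
  · exact ⟨C, by simp; tauto, le_rfl⟩

theorem merge_le_iff {σ : Finpartition N} :
    π.merge hA hB ≤ σ ↔ π ≤ σ ∧ ∃ C ∈ σ.parts, A ∪ B ⊆ C := by
  constructor
  · exact fun h => ⟨(le_merge hA hB).trans h, h (union_mem_merge hA hB)⟩
  · rintro ⟨h1, h2⟩ C hC
    rcases Finset.mem_insert.1 hC with rfl | hC
    · exact h2
    · exact h1 (Finset.mem_of_mem_erase (Finset.mem_of_mem_erase hC))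

theorem union_notMem_parts (hA : A ∈ π.parts) (hB : B ∈ π.parts) (hAB : A ≠ B) : A ∪ B ∉ π.parts := fun h => by
  obtain ⟨x, hx⟩ := π.nonempty_of_mem_parts hA
  obtain ⟨y, hy⟩ := π.nonempty_of_mem_parts hB
  have h1 := π.eq_of_mem_parts hA h hx (by simp [hx])
  have h2 := π.eq_of_mem_parts hB h hy (by simp [hy])
  exact hAB (h1.trans h2.symm)

theorem card_merge_add_one (hAB : A ≠ B) :
    (π.merge hA hB).parts.card + 1 = π.parts.card := by
  have h1 := union_notMem_parts hA hB hAB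
  have h2 : B ∈ π.parts.erase A := Finset.mem_erase.2 ⟨hAB.symm, hB⟩
  rw [merge_parts, Finset.card_insert_of_notMem (by grind), Finset.card_erase_add_one h2,
    Finset.card_erase_add_one hA]

theorem sdiff_parts_merge (hAB : A ≠ B) : π.parts \ (π.merge hA hB).parts = {A, B} := by
  have h1 := union_notMem_parts hA hB hAB
  ext C
  simp only [merge_parts, Finset.mem_sdiff, Finset.mem_insert, Finset.mem_erase,
    Finset.mem_singleton]
  constructor
  · tauto
  · rintro (rfl | rfl)
    · exact ⟨hA, by rintro (h | h); exacts [h1 (h ▸ hA), h.2.1 rfl]⟩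
    · exact ⟨hB, by rintro (h | h); exacts [h1 (h ▸ hB), h.1 rfl]⟩

end Merge

/-- Some block of `σ` fits in no single block of `π`, so it contains two different ones, and these
can be merged while staying below `σ`. -/
theorem exists_merge_of_lt {π σ : Finpartition N} (h : π < σ) :
    ∃ (A B : Finset α) (hA : A ∈ π.parts) (hB : B ∈ π.parts), A ≠ B ∧ π.merge hA hB ≤ σ := by
  have h1 : ¬ σ ≤ π := h.not_ge
  have h2 : ∃ C ∈ σ.parts, ∀ A ∈ π.parts, ¬ C ⊆ A := by
    by_contra! h3
    exact h1 fun C hC => h3 C hC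
  obtain ⟨C, hC, hCA⟩ := h2
  obtain ⟨A, hA, hAC⟩ := exists_le_of_le h.le hC
  obtain ⟨y, hyC, hyA⟩ := Finset.not_subset.1 (hCA A hA)
  obtain ⟨B, hB, hyB⟩ := π.exists_mem (σ.le hC hyC)
  have hBC := subset_of_le_of_mem h.le hB hC hyB hyC
  refine ⟨A, B, hA, hB, fun h => hyA (h ▸ hyB), (merge_le_iff hA hB).2
    ⟨h.le, C, hC, Finset.union_subset hAC hBC⟩⟩

theorem exists_eq_merge {π σ : Finpartition N} (h : π ≤ σ)
    (hcard : π.parts.card = σ.parts.card + 1) :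
    ∃ (A B : Finset α) (hA : A ∈ π.parts) (hB : B ∈ π.parts), A ≠ B ∧ σ = π.merge hA hB := by
  have hlt : π < σ := lt_of_le_of_ne h (by rintro rfl; omega)
  obtain ⟨A, B, hA, hB, hAB, hle⟩ := exists_merge_of_lt hlt
  refine ⟨A, B, hA, hB, hAB, (eq_of_le_of_card_le hle ?_).symm⟩
  have := card_merge_add_one hA hB hAB
  omega

/-- The partition obtained from `π` by splitting the block `T` into `A` and `T \ A`. -/
def split (π : Finpartition N) {T A : Finset α} (hT : T ∈ π.parts) (hA : A.Nonempty)
    (hAT : A ⊂ T) : Finpartition N :=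
  ofExistsUnique (insert A (insert (T \ A) (π.parts.erase T)))
    (by
      have := π.le hT
      intro p hp
      rcases Finset.mem_insert.1 hp with rfl | hp
      · exact hAT.1.trans this
      rcases Finset.mem_insert.1 hp with rfl | hp
      · exact Finset.sdiff_subset.trans this
      · exact π.le (Finset.mem_of_mem_erase hp))
    (by
      intro x hx
      obtain ⟨C, hC, hxC⟩ := π.exists_mem hx
      have key : ∀ D ∈ π.parts, x ∈ D → D = C := fun D hD hxD => π.eq_of_mem_parts hD hC hxD hxC
      have hAT' := hAT.1
      by_cases hxA : x ∈ A
      · exact ⟨A, ⟨by simp, hxA⟩, by rintro D ⟨hD, hxD⟩; grind⟩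
      by_cases hxT : x ∈ T
      · exact ⟨T \ A, ⟨by simp, by simp [hxA, hxT]⟩, by rintro D ⟨hD, hxD⟩; grind⟩
      · exact ⟨C, ⟨by grind, hxC⟩, by rintro D ⟨hD, hxD⟩; grind⟩)
    (by
      have h1 := π.empty_notMem_parts
      have h2 := hA.ne_empty
      have h3 : T \ A ≠ ∅ := fun h => hAT.2 (Finset.sdiff_eq_empty_iff_subset.1 h)
      grind)

section Split

variable {π : Finpartition N} {T A : Finset α} (hT : T ∈ π.parts) (hA : A.Nonempty) (hAT : A ⊂ T)

@[simp]
theorem split_parts :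
    (π.split hT hA hAT).parts = insert A (insert (T \ A) (π.parts.erase T)) := rfl

theorem split_le : π.split hT hA hAT ≤ π := by
  intro C hC
  simp only [split_parts, Finset.mem_insert, Finset.mem_erase] at hC
  rcases hC with rfl | rfl | ⟨-, hC⟩
  · exact ⟨T, hT, hAT.1⟩
  · exact ⟨T, hT, Finset.sdiff_subset⟩
  · exact ⟨C, hC, le_rfl⟩

theorem notMem_parts_of_ssubset (hT : T ∈ π.parts) {B : Finset α} (hB : B.Nonempty) (hBT : B ⊂ T) :
    B ∉ π.parts := fun h => by
  obtain ⟨x, hx⟩ := hB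
  exact hBT.ne (π.eq_of_mem_parts h hT hx (hBT.1 hx))

theorem sdiff_nonempty_of_ssubset (hAT : A ⊂ T) : (T \ A).Nonempty := Finset.sdiff_nonempty.2 hAT.2

theorem sdiff_ssubset_of_ssubset (hA : A.Nonempty) (hAT : A ⊂ T) : T \ A ⊂ T :=
  Finset.sdiff_ssubset hAT.1 hA

theorem card_split : (π.split hT hA hAT).parts.card = π.parts.card + 1 := by
  have h1 := notMem_parts_of_ssubset hT hA hAT
  have h2 := notMem_parts_of_ssubset hT (sdiff_nonempty_of_ssubset hAT) (sdiff_ssubset_of_ssubset hA hAT)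
  obtain ⟨x, hx⟩ := id hA
  rw [split_parts, Finset.card_insert_of_notMem, Finset.card_insert_of_notMem (by grind),
    Finset.card_erase_add_one hT]
  grind

theorem split_parts_sdiff : (π.split hT hA hAT).parts \ π.parts = {A, T \ A} := by
  have h1 := notMem_parts_of_ssubset hT hA hAT
  have h2 := notMem_parts_of_ssubset hT (sdiff_nonempty_of_ssubset hAT) (sdiff_ssubset_of_ssubset hA hAT)
  ext C
  simp only [split_parts, Finset.mem_sdiff, Finset.mem_insert, Finset.mem_erase,
    Finset.mem_singleton]
  grind

end Split

/-- Splitting undoes merging; this turns the description of covers by merges into one of lower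
covers by splits. -/
theorem eq_split_merge {π : Finpartition N} {A B : Finset α} (hA : A ∈ π.parts)
    (hB : B ∈ π.parts) (hAB : A ≠ B) :
    ∃ h : A ⊂ A ∪ B,
      π = (π.merge hA hB).split (union_mem_merge hA hB) (π.nonempty_of_mem_parts hA) h := by
  have hd : Disjoint A B := π.disjoint hA hB hAB
  have hB' := π.nonempty_of_mem_parts hB
  have hss : A ⊂ A ∪ B := by
    refine ⟨Finset.subset_union_left, fun h => ?_⟩
    obtain ⟨y, hy⟩ := hB'
    exact Finset.disjoint_left.1 hd (h (by simp [hy])) hy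
  refine ⟨hss, ext_of_subset fun C hC => ?_⟩
  have h1 : (A ∪ B) \ A = B := by
    rw [Finset.union_sdiff_left, Finset.sdiff_eq_self_of_disjoint hd.symm]
  have h2 := union_notMem_parts hA hB hAB
  rw [split_parts, h1, merge_parts]
  grind

/-- There are finitely many partitions, so the meet of all common upper bounds is available. -/
theorem exists_isLUB (π σ : Finpartition N) : ∃ ρ, IsLUB {π, σ} ρ := by
  classical
  have hfin : (upperBounds {π, σ}).Finite := Set.toFinite _
  refine ⟨hfin.toFinset.inf id, ?_, ?_⟩
  · intro x hx
    exact Finset.le_inf fun z hz => (hfin.mem_toFinset.1 hz) hx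
  · intro z hz
    exact Finset.inf_le (f := id) (hfin.mem_toFinset.2 hz)

end Finpartition

/-! ### The order on embedded subsets and its covers -/

namespace EmbeddedSubset

variable {α : Type*} [DecidableEq α] {N : Finset α}

theorem nonempty_ground (P : EmbeddedSubset N) : N.Nonempty :=
  P.block_nonempty.mono (P.part.le P.mem)

theorem card_parts_pos (P : EmbeddedSubset N) : 0 < P.part.parts.card :=
  Finset.card_pos.2 ⟨_, P.mem⟩

/-- A point of `P.block` lies in the blocks of both `Q` and `R`, so the comparison of partitions
carries the blocks along. Above a fixed `P`, only partitions matter. -/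
theorem le_of_part_le {P Q R : EmbeddedSubset N} (hQ : P ≤ Q) (hR : P ≤ R)
    (h : Q.part ≤ R.part) : Q ≤ R := by
  obtain ⟨x, hx⟩ := P.block_nonempty
  exact ⟨Finpartition.subset_of_le_of_mem h Q.mem R.mem (hQ.1 hx) (hR.1 hx), h⟩

theorem part_lt_of_lt {P Q : EmbeddedSubset N} (h : P < Q) : P.part < Q.part :=
  lt_of_le_of_ne h.le.2 fun he => h.not_ge (le_of_part_le h.le le_rfl he.ge)

theorem card_lt_of_lt {P Q : EmbeddedSubset N} (h : P < Q) :
    Q.part.parts.card < P.part.parts.card :=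
  Finpartition.card_lt_of_lt (part_lt_of_lt h)

/-- The embedded subset `(T, σ)`, where `σ` is coarser than the partition of `P` and `T` is the
block of `σ` that contains the block of `P`. -/
noncomputable def coarsen (P : EmbeddedSubset N) (σ : Finpartition N) (h : P.part ≤ σ) :
    EmbeddedSubset N where
  block := (h P.mem).choose
  part := σ
  mem := (h P.mem).choose_spec.1

@[simp]
theorem coarsen_part (P : EmbeddedSubset N) (σ : Finpartition N) (h : P.part ≤ σ) :
    (P.coarsen σ h).part = σ := rfl

theorem le_coarsen (P : EmbeddedSubset N) (σ : Finpartition N) (h : P.part ≤ σ) :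
    P ≤ P.coarsen σ h :=
  ⟨(h P.mem).choose_spec.2, h⟩

theorem coarsen_le {P R : EmbeddedSubset N} {σ : Finpartition N} {h : P.part ≤ σ} (hR : P ≤ R)
    (hσ : σ ≤ R.part) : P.coarsen σ h ≤ R :=
  le_of_part_le (le_coarsen P σ h) hR hσ

theorem covBy_of_card {P Q : EmbeddedSubset N} (h : P ≤ Q)
    (hc : P.part.parts.card = Q.part.parts.card + 1) : P ⋖ Q := by
  refine ⟨lt_of_le_of_ne h ?_, fun R h1 h2 => ?_⟩
  · rintro rfl
    omega
  · have := card_lt_of_lt h1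
    have := card_lt_of_lt h2
    omega

/-- Some merge of two blocks of `P` stays below `Q`. It lies strictly above `P`, so the cover forces
it to be `Q`. -/
theorem card_of_covBy {P Q : EmbeddedSubset N} (h : P ⋖ Q) :
    P.part.parts.card = Q.part.parts.card + 1 := by
  obtain ⟨A, B, hA, hB, hAB, hle⟩ := Finpartition.exists_merge_of_lt (part_lt_of_lt h.lt)
  have h1 := le_coarsen P _ (Finpartition.le_merge hA hB)
  have h2 : P.coarsen _ (Finpartition.le_merge hA hB) ≤ Q := coarsen_le h.le hle
  have h3 := Finpartition.card_merge_add_one hA hB hAB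
  rcases h.eq_or_eq h1 h2 with h4 | h4
  · have h5 := congrArg (fun R => R.part.parts.card) h4
    simp only [coarsen_part] at h5
    omega
  · have h5 := congrArg (fun R => R.part.parts.card) h4
    simp only [coarsen_part] at h5
    omega

theorem exists_part_eq_merge {P Q : EmbeddedSubset N} (h : P ⋖ Q) :
    ∃ (A B : Finset α) (hA : A ∈ P.part.parts) (hB : B ∈ P.part.parts), A ≠ B ∧
      Q.part = P.part.merge hA hB :=
  Finpartition.exists_eq_merge h.le.2 (card_of_covBy h)

theorem covBy_coarsen_merge (P : EmbeddedSubset N) {A B : Finset α} (hA : A ∈ P.part.parts)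
    (hB : B ∈ P.part.parts) (hAB : A ≠ B) :
    P ⋖ P.coarsen _ (Finpartition.le_merge hA hB) :=
  covBy_of_card (le_coarsen _ _ _) (Finpartition.card_merge_add_one hA hB hAB).symm

theorem atom_le {i : α} (hi : i ∈ N) {P : EmbeddedSubset N} : atom i hi ≤ P ↔ i ∈ P.block :=
  ⟨fun h => h.1 (Finset.mem_singleton_self i),
    fun h => ⟨Finset.singleton_subset_iff.2 h, bot_le⟩⟩

theorem isMin_atom {i : α} (hi : i ∈ N) : IsMin (atom i hi) := fun P hP => by
  obtain ⟨j, hj⟩ := P.block_nonempty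
  obtain rfl : j = i := Finset.mem_singleton.1 (hP.1 hj)
  exact (atom_le hi).2 hj

theorem isMin_iff {P : EmbeddedSubset N} : IsMin P ↔ ∃ i, ∃ hi : i ∈ N, P = atom i hi := by
  constructor
  · intro h
    obtain ⟨i, hi⟩ := P.block_nonempty
    have hiN := P.part.le P.mem hi
    exact ⟨i, hiN, h.eq_of_ge ((atom_le hiN).2 hi)⟩
  · rintro ⟨i, hi, rfl⟩
    exact isMin_atom hi

theorem eq_whole_of_block_eq {P : EmbeddedSubset N} (h : P.block = N) :
    P = whole P.nonempty_ground := by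
  refine le_antisymm (P.le_whole _) ⟨h.ge, fun B hB => ⟨P.block, P.mem, ?_⟩⟩
  rw [h]
  exact Finpartition.le _ hB

theorem block_eq_iff_card_eq_one {P : EmbeddedSubset N} :
    P.block = N ↔ P.part.parts.card = 1 := by
  constructor
  · intro h
    rw [eq_whole_of_block_eq h]
    simp [whole]
  · intro h
    obtain ⟨B, hB⟩ := Finset.card_eq_one.1 h
    have h1 := P.mem
    rw [hB, Finset.mem_singleton] at h1
    have h2 := P.part.sup_parts
    rw [hB, Finset.sup_singleton] at h2
    exact h1.trans h2

/-- The embedded subset `(A, {A, N \ A})`. -/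
def binary (A : Finset α) (hA : A.Nonempty) (hAN : A ⊂ N) : EmbeddedSubset N where
  block := A
  part := (Finpartition.indiscrete (a := N)
    ((hA.mono hAN.1).ne_empty)).split (T := N) (by simp) hA hAN
  mem := by simp

theorem card_binary {A : Finset α} (hA : A.Nonempty) (hAN : A ⊂ N) :
    (binary A hA hAN).part.parts.card = 2 := by
  simp only [binary]
  rw [Finpartition.card_split]
  simp

end EmbeddedSubset

/-! ### Rank, atoms, co-atoms, joins, complements and semimodularity -/

namespace EmbLattice

variable {α : Type*} [DecidableEq α] {N : Finset α}

open EmbeddedSubset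

/-- The rank of an element: `0` for `⊥`, and `n - k + 1` for an embedded subset with `k` blocks. -/
def rank : EmbLattice N → ℕ
  | ⊥ => 0
  | (P : EmbeddedSubset N) => N.card - P.part.parts.card + 1

@[simp]
theorem rank_bot : rank (⊥ : EmbLattice N) = 0 := rfl

@[simp]
theorem rank_coe (P : EmbeddedSubset N) :
    rank (P : EmbLattice N) = N.card - P.part.parts.card + 1 := rfl

theorem rank_strictMono : StrictMono (rank : EmbLattice N → ℕ) := by
  intro x y h
  induction y using WithBot.recBotCoe with
  | bot => exact absurd h not_lt_bot
  | coe Q =>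
    induction x using WithBot.recBotCoe with
    | bot => simp
    | coe P =>
      have h1 := card_lt_of_lt (WithBot.coe_lt_coe.1 h)
      have h2 := P.part.card_parts_le_card
      simp only [rank_coe]
      omega

theorem card_of_isMin {P : EmbeddedSubset N} (h : IsMin P) : P.part.parts.card = N.card := by
  obtain ⟨i, hi, rfl⟩ := isMin_iff.1 h
  exact Finpartition.card_bot N

theorem rank_covBy {x y : EmbLattice N} (h : x ⋖ y) : rank y = rank x + 1 := by
  induction y using WithBot.recBotCoe with
  | bot => exact absurd h.lt not_lt_bot
  | coe Q =>
    induction x using WithBot.recBotCoe with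
    | bot =>
      rw [rank_coe, card_of_isMin (WithBot.bot_covBy_coe.1 h)]
      simp
    | coe P =>
      have h1 := card_of_covBy (WithBot.coe_covBy_coe.1 h)
      have h2 := P.part.card_parts_le_card
      simp only [rank_coe]
      omega

theorem height_eq_rank (x : EmbLattice N) : Order.height x = rank x :=
  Order.height_eq_of_rank rank rank_bot rank_strictMono (fun _ _ => rank_covBy) x

theorem jordanDedekind : JordanDedekind (EmbLattice N) :=
  JordanDedekind.of_rank rank fun _ _ => rank_covBy

theorem top_eq (hN : N.Nonempty) :
    (⊤ : EmbLattice N) = ((whole hN : EmbeddedSubset N) : EmbLattice N) := dif_pos hN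

theorem coe_eq_top_iff_block {P : EmbeddedSubset N} : (P : EmbLattice N) = ⊤ ↔ P.block = N := by
  rw [top_eq P.nonempty_ground, WithBot.coe_inj]
  exact ⟨fun h => h ▸ rfl, eq_whole_of_block_eq⟩

theorem coe_eq_top_iff {P : EmbeddedSubset N} :
    (P : EmbLattice N) = ⊤ ↔ P.part.parts.card = 1 :=
  coe_eq_top_iff_block.trans block_eq_iff_card_eq_one

theorem rank_top (hN : N.Nonempty) : rank (⊤ : EmbLattice N) = N.card := by
  have h := Finset.card_pos.2 hN
  rw [top_eq hN, rank_coe]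
  simp only [whole, Finpartition.indiscrete_parts, Finset.card_singleton]
  omega

theorem krullDim_eq (hN : N.Nonempty) : Order.krullDim (EmbLattice N) = N.card := by
  rw [← Order.height_top_eq_krullDim, height_eq_rank, rank_top hN]
  rfl

theorem isAtom_iff {x : EmbLattice N} :
    IsAtom x ↔ ∃ i, ∃ hi : i ∈ N, x = ((atom i hi : EmbeddedSubset N) : EmbLattice N) := by
  rw [← bot_covBy_iff]
  induction x using WithBot.recBotCoe with
  | bot => simp
  | coe P =>
    rw [WithBot.bot_covBy_coe, isMin_iff]
    simp only [WithBot.coe_inj]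

theorem isCoatom_iff (hN : 2 ≤ N.card) {x : EmbLattice N} :
    IsCoatom x ↔ ∃ P : EmbeddedSubset N, x = P ∧ P.part.parts.card = 2 := by
  have hne : N.Nonempty := Finset.card_pos.1 (by omega)
  constructor
  · intro h
    have h1 := rank_covBy h.covBy_top
    rw [rank_top hne] at h1
    induction x using WithBot.recBotCoe with
    | bot =>
      rw [rank_bot] at h1
      omega
    | coe P =>
      refine ⟨P, rfl, ?_⟩
      have h2 := P.part.card_parts_le_card
      rw [rank_coe] at h1
      omega
  · rintro ⟨P, rfl, hP⟩
    refine ⟨fun h => ?_, fun y hy => ?_⟩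
    · have := coe_eq_top_iff.1 h
      omega
    · induction y using WithBot.recBotCoe with
      | bot => exact absurd hy not_lt_bot
      | coe Q =>
        have h1 := card_lt_of_lt (WithBot.coe_lt_coe.1 hy)
        have h2 := Q.card_parts_pos
        exact coe_eq_top_iff.2 (by omega)

theorem inf_coe_of_nonempty {P Q : EmbeddedSubset N} (h : (P.block ∩ Q.block).Nonempty) :
    (P : EmbLattice N) ⊓ Q = ((P.inter Q h : EmbeddedSubset N) : EmbLattice N) := dif_pos h

theorem inf_coe_of_eq_empty {P Q : EmbeddedSubset N} (h : P.block ∩ Q.block = ∅) :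
    (P : EmbLattice N) ⊓ Q = ⊥ :=
  dif_neg (Finset.not_nonempty_iff_eq_empty.2 h)

/-- The join: merge the blocks of `π ∨ π'` that contain the two distinguished blocks. -/
theorem exists_sup_eq (P P' : EmbeddedSubset N) :
    ∃ σ : Finpartition N, IsLUB {P.part, P'.part} σ ∧
      ∃ T ∈ σ.parts, ∃ T' ∈ σ.parts, P.block ⊆ T ∧ P'.block ⊆ T' ∧
        ∃ R : EmbeddedSubset N, R.block = T ∪ T' ∧
          R.part.parts = insert (T ∪ T') ((σ.parts.erase T).erase T') ∧
          (P : EmbLattice N) ⊔ P' = R := by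
  obtain ⟨σ, hσ⟩ := Finpartition.exists_isLUB P.part P'.part
  have h1 : P.part ≤ σ := hσ.1 (by simp)
  have h2 : P'.part ≤ σ := hσ.1 (by simp)
  obtain ⟨T, hT, hPT⟩ := h1 P.mem
  obtain ⟨T', hT', hPT'⟩ := h2 P'.mem
  let R : EmbeddedSubset N := ⟨T ∪ T', σ.merge hT hT', Finpartition.union_mem_merge hT hT'⟩
  refine ⟨σ, hσ, T, hT, T', hT', hPT, hPT', R, rfl, rfl, ?_⟩
  refine le_antisymm (sup_le ?_ ?_) ?_
  · exact WithBot.coe_le_coe.2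
      ⟨hPT.trans Finset.subset_union_left, h1.trans (Finpartition.le_merge hT hT')⟩
  · exact WithBot.coe_le_coe.2
      ⟨hPT'.trans Finset.subset_union_right, h2.trans (Finpartition.le_merge hT hT')⟩
  -- The join is some embedded subset `U`, not `⊥`. Its partition is coarser than `σ`, and its block
  -- meets `T` and `T'`, hence contains both; this puts it above the merge.
  · generalize hu : (P : EmbLattice N) ⊔ P' = u
    have hPu : (P : EmbLattice N) ≤ u := hu ▸ le_sup_left
    have hPu' : (P' : EmbLattice N) ≤ u := hu ▸ le_sup_right
    induction u using WithBot.recBotCoe with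
    | bot => exact absurd hPu (WithBot.not_coe_le_bot P)
    | coe U =>
      have h3 := WithBot.coe_le_coe.1 hPu
      have h4 := WithBot.coe_le_coe.1 hPu'
      have h5 : σ ≤ U.part := hσ.2 (by
        rintro ρ (rfl | rfl)
        exacts [h3.2, h4.2])
      obtain ⟨x, hx⟩ := P.block_nonempty
      obtain ⟨x', hx'⟩ := P'.block_nonempty
      have h6 : T ∪ T' ⊆ U.block := Finset.union_subset
        (Finpartition.subset_of_le_of_mem h5 hT U.mem (hPT hx) (h3.1 hx))
        (Finpartition.subset_of_le_of_mem h5 hT' U.mem (hPT' hx') (h4.1 hx'))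
      exact WithBot.coe_le_coe.2
        ⟨h6, (Finpartition.merge_le_iff hT hT').2 ⟨h5, U.block, U.mem, h6⟩⟩

/-- Disjoint blocks send the meet to `⊥`. The block of the join contains both blocks, hence is `N`,
and this alone forces the top element. The remaining blocks play no role. -/
theorem isCompl_of_block_eq {P Q : EmbeddedSubset N} (h : Q.block = N \ P.block) :
    IsCompl (P : EmbLattice N) Q := by
  constructor
  · rw [disjoint_iff]
    exact inf_coe_of_eq_empty (by rw [h, Finset.inter_sdiff_self])
  · rw [codisjoint_iff]
    obtain ⟨σ, -, T, -, T', -, hT, hT', R, hR, -, hsup⟩ := exists_sup_eq P Q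
    rw [hsup, coe_eq_top_iff_block]
    refine (R.part.le R.mem).antisymm fun x hx => ?_
    rw [hR, Finset.mem_union]
    by_cases hxP : x ∈ P.block
    · exact Or.inl (hT hxP)
    · exact Or.inr (hT' (by rw [h]; simp [hx, hxP]))

theorem complementedLattice : ComplementedLattice (EmbLattice N) := by
  refine ⟨fun x => ?_⟩
  induction x using WithBot.recBotCoe with
  | bot => exact ⟨⊤, isCompl_bot_top⟩
  | coe P =>
    by_cases h : P.block = N
    · rw [coe_eq_top_iff_block.2 h]
      exact ⟨⊥, isCompl_top_bot⟩
    · have h1 := P.part.le P.mem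
      refine ⟨(binary (N \ P.block) (Finset.sdiff_nonempty.2 fun h2 => h (h1.antisymm h2))
        (Finset.sdiff_ssubset h1 P.block_nonempty) : EmbeddedSubset N), ?_⟩
      exact isCompl_of_block_eq rfl

/-- If `x ≰ Q` lies below the result of merging two blocks of `Q`, then `x ⊔ Q` covers `Q`. -/
theorem covBy_sup_of_merge {Q : EmbeddedSubset N} {x : EmbLattice N} {A B : Finset α}
    (hA : A ∈ Q.part.parts) (hB : B ∈ Q.part.parts) (hAB : A ≠ B)
    (hx : x ≤ ((Q.coarsen _ (Finpartition.le_merge hA hB) : EmbeddedSubset N) : EmbLattice N))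
    (hxQ : ¬ x ≤ Q) : (Q : EmbLattice N) ⋖ x ⊔ Q := by
  have h1 := WithBot.coe_covBy_coe.2 (covBy_coarsen_merge Q hA hB hAB)
  rcases h1.eq_or_eq (c := x ⊔ Q) le_sup_right (sup_le hx h1.le) with h2 | h2
  · exact absurd (h2 ▸ le_sup_left) hxQ
  · rwa [h2]

/-- If the distinguished blocks meet, `P` arises from the meet by merging `A` and `B`, and joining
with `Q` merges the blocks of `Q` containing them. If they are disjoint, `P` is an atom `i`, and
joining merges `Q.block` with the block containing `i`. Either way one merge suffices. -/
theorem isUpperModularLattice : IsUpperModularLattice (EmbLattice N) := by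
  refine ⟨fun {x y} h => ?_⟩
  have hxy : ¬ x ≤ y := fun hle => h.lt.ne (inf_eq_left.2 hle)
  induction y using WithBot.recBotCoe with
  | bot => simpa using h
  | coe Q =>
    induction x using WithBot.recBotCoe with
    | bot => exact absurd bot_le hxy
    | coe P =>
      by_cases hne : (P.block ∩ Q.block).Nonempty
      · rw [inf_coe_of_nonempty hne] at h
        set R := P.inter Q hne with hR
        have hRQ : R ≤ Q := ⟨Finset.inter_subset_right, inf_le_right⟩
        have hRP := WithBot.coe_covBy_coe.1 h
        obtain ⟨A, B, hA, hB, hAB, hP⟩ := exists_part_eq_merge hRP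
        obtain ⟨A', hA', hAA'⟩ := hRQ.2 hA
        obtain ⟨B', hB', hBB'⟩ := hRQ.2 hB
        -- Applied with `U = Q` this shows `A' ≠ B'`; applied with the merge of `A'` and `B'` it
        -- bounds the join.
        have hle : ∀ U : EmbeddedSubset N, Q ≤ U → (∃ C ∈ U.part.parts, A ∪ B ⊆ C) → P ≤ U := by
          intro U hU hC
          refine le_of_part_le hRP.le (hRQ.trans hU) ?_
          rw [hP]
          exact (Finpartition.merge_le_iff hA hB).2 ⟨(hRQ.trans hU).2, hC⟩
        have hAB' : A' ≠ B' := by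
          rintro rfl
          exact hxy (WithBot.coe_le_coe.2
            (hle Q le_rfl ⟨A', hA', Finset.union_subset hAA' hBB'⟩))
        refine covBy_sup_of_merge hA' hB' hAB' (WithBot.coe_le_coe.2
          (hle _ (le_coarsen _ _ _) ⟨A' ∪ B', Finpartition.union_mem_merge hA' hB', ?_⟩)) hxy
        exact Finset.union_subset_union hAA' hBB'
      · rw [inf_coe_of_eq_empty (Finset.not_nonempty_iff_eq_empty.1 hne), bot_covBy_iff,
          isAtom_iff] at h
        obtain ⟨i, hi, h⟩ := h
        obtain rfl := WithBot.coe_inj.1 h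
        obtain ⟨B, hB, hiB⟩ := Q.part.exists_mem hi
        have hQB : Q.block ≠ B := by
          rintro rfl
          exact hxy (WithBot.coe_le_coe.2 ((atom_le hi).2 hiB))
        refine covBy_sup_of_merge Q.mem hB hQB (WithBot.coe_le_coe.2 ((atom_le hi).2 ?_)) hxy
        obtain ⟨y, hy⟩ := Q.block_nonempty
        have h1 : Q.block ∪ B ⊆ (Q.coarsen _ (Finpartition.le_merge Q.mem hB)).block := by
          have h2 := (le_coarsen Q _ (Finpartition.le_merge Q.mem hB)).1 hy
          exact Finpartition.subset_of_le_of_mem le_rfl (Finpartition.union_mem_merge Q.mem hB)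
            (mem _) (Finset.mem_union_left _ hy) h2
        exact h1 (Finset.mem_union_right _ hiB)

end EmbLattice

/-! ### The elements `({i}, π_jk)` and the failing lattice laws -/

namespace EmbeddedSubset

variable {α : Type*} [DecidableEq α] {N : Finset α}

/-- The embedded subset `({i}, π_jk)`, where `π_jk` has the block `{j, k}` and singletons. -/
def singletonPair {i j k : α} (hi : i ∈ N) (hj : j ∈ N) (hk : k ∈ N)
    (h : i ∉ ({j, k} : Finset α)) : EmbeddedSubset N where
  block := {i}
  part := (⊥ : Finpartition N).merge (Finpartition.mem_bot_iff.2 ⟨j, hj, rfl⟩)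
    (Finpartition.mem_bot_iff.2 ⟨k, hk, rfl⟩)
  mem := by
    simp only [Finset.mem_insert, Finset.mem_singleton, not_or] at h
    simp only [Finpartition.merge_parts, Finset.mem_insert, Finset.mem_erase, ne_eq,
      Finset.singleton_inj, Finpartition.mem_bot_iff]
    exact Or.inr ⟨h.2, h.1, i, hi, rfl⟩

theorem singletonPair_parts {i j k : α} (hi : i ∈ N) (hj : j ∈ N) (hk : k ∈ N)
    (h : i ∉ ({j, k} : Finset α)) :
    (singletonPair hi hj hk h).part.parts =
      insert {j, k} ((N \ {j, k}).image fun a => {a}) := by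
  ext C
  simp only [singletonPair, Finpartition.merge_parts, Finset.mem_insert, Finset.mem_erase, ne_eq,
    Finpartition.mem_bot_iff, Finset.mem_image, Finset.mem_sdiff, Finset.mem_singleton, not_or]
  refine or_congr Iff.rfl ⟨?_, ?_⟩
  · rintro ⟨h1, h2, a, ha, rfl⟩
    exact ⟨a, ⟨ha, by simpa using h2, by simpa using h1⟩, rfl⟩
  · rintro ⟨a, ⟨ha, h1, h2⟩, rfl⟩
    exact ⟨by simpa using h2, by simpa using h1, a, ha, rfl⟩

theorem atom_covBy_singletonPair {i j k : α} (hi : i ∈ N) (hj : j ∈ N) (hk : k ∈ N)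
    (h : i ∉ ({j, k} : Finset α)) (hjk : j ≠ k) : atom i hi ⋖ singletonPair hi hj hk h := by
  refine covBy_of_card ((atom_le hi).2 (by simp [singletonPair])) ?_
  exact (Finpartition.card_merge_add_one (Finpartition.mem_bot_iff.2 ⟨j, hj, rfl⟩)
    (Finpartition.mem_bot_iff.2 ⟨k, hk, rfl⟩) (by simpa using hjk)).symm

end EmbeddedSubset

namespace EmbLattice

variable {α : Type*} [DecidableEq α] {N : Finset α}

open EmbeddedSubset

/-- A sublattice isomorphic to the pentagon. -/
theorem exists_pentagon {i j k : α} (hi : i ∈ N) (hj : j ∈ N) (hk : k ∈ N)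
    (h : i ∉ ({j, k} : Finset α)) (hjk : j ≠ k) :
    ∃ a b c : EmbLattice N, a < b ∧ a ⊔ c = ⊤ ∧ a ⊓ c = ⊥ ∧ b ⊓ c = ⊥ := by
  have hss : N \ {i} ⊂ N := Finset.sdiff_ssubset (by simpa using hi) (by simp)
  have hne : (N \ {i}).Nonempty := ⟨j, by
    simp only [Finset.mem_insert, Finset.mem_singleton, not_or] at h
    simpa [hj] using Ne.symm h.1⟩
  -- The co-atom with block `N \ {i}` is a complement of both elements, because both have
  -- distinguished block `{i}`.
  have h1 : IsCompl ((atom i hi : EmbeddedSubset N) : EmbLattice N)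
    ((binary (N \ {i}) hne hss : EmbeddedSubset N) : EmbLattice N) := isCompl_of_block_eq rfl
  have h2 : IsCompl ((singletonPair hi hj hk h : EmbeddedSubset N) : EmbLattice N)
    ((binary (N \ {i}) hne hss : EmbeddedSubset N) : EmbLattice N) := isCompl_of_block_eq rfl
  exact ⟨_, _, _, WithBot.coe_lt_coe.2 (atom_covBy_singletonPair hi hj hk h hjk).lt,
    h1.sup_eq_top, h1.inf_eq_bot, h2.inf_eq_bot⟩

theorem exists_mem_three (hN : 2 < N.card) :
    ∃ i j k : α, i ∈ N ∧ j ∈ N ∧ k ∈ N ∧ i ∉ ({j, k} : Finset α) ∧ j ≠ k := by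
  obtain ⟨i, j, k, hi, hj, hk, hij, hik, hjk⟩ := Finset.two_lt_card_iff.1 hN
  exact ⟨i, j, k, hi, hj, hk, by simp [hij, hik], hjk⟩

theorem exists_not_distrib (hN : 2 < N.card) :
    ∃ x y z : EmbLattice N, x ⊓ (y ⊔ z) ≠ (x ⊓ y) ⊔ (x ⊓ z) := by
  obtain ⟨i, j, k, hi, hj, hk, h, hjk⟩ := exists_mem_three hN
  obtain ⟨a, b, c, h1, h2, h3, h4⟩ := exists_pentagon hi hj hk h hjk
  refine ⟨b, a, c, fun h5 => h1.ne ?_⟩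
  rw [h2, inf_top_eq, h4, sup_bot_eq, inf_eq_right.2 h1.le] at h5
  exact h5.symm

theorem not_isDistribLattice (hN : 2 < N.card) : ¬ IsDistribLattice (EmbLattice N) := by
  obtain ⟨x, y, z, h⟩ := exists_not_distrib hN
  exact fun hd => h (hd x y z)

theorem not_distribOnIcc_bot_top (hN : 2 < N.card) :
    ¬ DistribOnIcc (⊥ : EmbLattice N) ⊤ := by
  obtain ⟨x, y, z, h⟩ := exists_not_distrib hN
  exact fun hd => h (hd x ⟨bot_le, le_top⟩ y ⟨bot_le, le_top⟩ z ⟨bot_le, le_top⟩)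

theorem not_isModularLattice (hN : 2 < N.card) : ¬ IsModularLattice (EmbLattice N) := by
  obtain ⟨i, j, k, hi, hj, hk, h, hjk⟩ := exists_mem_three hN
  obtain ⟨a, b, c, h1, h2, h3, h4⟩ := exists_pentagon hi hj hk h hjk
  intro hm
  have h5 := hm.sup_inf_le_assoc_of_le c h1.le
  rw [h2, top_inf_eq, inf_comm, h4, sup_bot_eq] at h5
  exact h1.not_ge h5

/-- A block containing every point is `N`. At `x = ⊥`, the upper local interval is thus the whole
lattice. -/
theorem isLUB_atoms (hN : N.Nonempty) :
    IsLUB (insert ⊥ {y : EmbLattice N | ⊥ ⋖ y}) ⊤ := by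
  refine ⟨fun _ _ => le_top, fun u hu => ?_⟩
  have h1 : ∀ i (hi : i ∈ N), ((atom i hi : EmbeddedSubset N) : EmbLattice N) ≤ u :=
    fun i hi => hu (Set.mem_insert_of_mem _ (bot_covBy_iff.2 (isAtom_iff.2 ⟨i, hi, rfl⟩)))
  induction u using WithBot.recBotCoe with
  | bot =>
    obtain ⟨i, hi⟩ := hN
    exact absurd (h1 i hi) (WithBot.not_coe_le_bot _)
  | coe U =>
    refine (coe_eq_top_iff_block.2 ((U.part.le U.mem).antisymm fun i hi => ?_)).ge
    exact (atom_le hi).1 (WithBot.coe_le_coe.1 (h1 i hi))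

/-- An embedded subset with `i` in its block is not below the co-atom whose block is `N \ {i}`. -/
theorem isGLB_coatoms (hN : 2 ≤ N.card) :
    IsGLB (insert ⊤ {y : EmbLattice N | y ⋖ ⊤}) ⊥ := by
  refine ⟨fun _ _ => bot_le, fun u hu => ?_⟩
  induction u using WithBot.recBotCoe with
  | bot => exact le_rfl
  | coe U =>
    exfalso
    obtain ⟨i, hi⟩ := U.block_nonempty
    have hiN := U.part.le U.mem hi
    obtain ⟨j, hj, hji⟩ := Finset.exists_mem_ne (by omega : 1 < N.card) i
    have hss : N \ {i} ⊂ N := Finset.sdiff_ssubset (by simpa using hiN) (by simp)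
    have hne : (N \ {i}).Nonempty := ⟨j, by simp [hj, hji]⟩
    have h1 : IsCoatom ((binary (N \ {i}) hne hss : EmbeddedSubset N) : EmbLattice N) :=
      (isCoatom_iff hN).2 ⟨_, rfl, card_binary hne hss⟩
    have h2 := (WithBot.coe_le_coe.1 (hu (Set.mem_insert_of_mem _ h1.covBy_top))).1 hi
    simp [binary] at h2

theorem not_isUpperLocallyDistrib (hN : 2 < N.card) :
    ¬ IsUpperLocallyDistrib (EmbLattice N) := fun h =>
  not_distribOnIcc_bot_top hN (h ⊥ ⊤ (isLUB_atoms (Finset.card_pos.1 (by omega))))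

theorem not_isLowerLocallyDistrib (hN : 2 < N.card) :
    ¬ IsLowerLocallyDistrib (EmbLattice N) := fun h =>
  not_distribOnIcc_bot_top hN (h ⊤ ⊥ (isGLB_coatoms hN.le))

/-- The only atom below `({i}, π_jk)` is the strictly smaller atom at `i`. -/
theorem not_isAtomistic (hN : 2 < N.card) : ¬ IsAtomistic (EmbLattice N) := by
  obtain ⟨i, j, k, hi, hj, hk, h, hjk⟩ := exists_mem_three hN
  have hcov := atom_covBy_singletonPair hi hj hk h hjk
  intro hat
  obtain ⟨s, hs, hsat⟩ := hat.isLUB_atoms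
    ((singletonPair hi hj hk h : EmbeddedSubset N) : EmbLattice N)
  refine hcov.lt.not_ge (WithBot.coe_le_coe.1 (hs.2 fun a ha => ?_))
  obtain ⟨i', hi', rfl⟩ := isAtom_iff.1 (hsat a ha)
  have h1 := (atom_le hi').1 (WithBot.coe_le_coe.1 (hs.1 ha))
  obtain rfl : i' = i := by simpa [singletonPair] using h1
  exact le_rfl

end EmbLattice

/-! ### Upper intervals by labelling the blocks -/

namespace Finpartition

variable {α ι : Type*} [DecidableEq α] {N : Finset α}
  {π : Finpartition N} (e : ι ≃ {T : Finset α // T ∈ π.parts})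

theorem exists_label {x : α} (hx : x ∈ N) : ∃ j, x ∈ (e j).1 := by
  obtain ⟨T, hT, hxT⟩ := π.exists_mem hx
  exact ⟨e.symm ⟨T, hT⟩, by simpa using hxT⟩

theorem exists_mem_label (j : ι) : ∃ x ∈ (e j).1, x ∈ N := by
  obtain ⟨x, hx⟩ := π.nonempty_of_mem_parts (e j).2
  exact ⟨x, hx, π.le (e j).2 hx⟩

theorem label_unique {x : α} {j j' : ι} (h : x ∈ (e j).1) (h' : x ∈ (e j').1) : j = j' :=
  e.injective (Subtype.ext (π.eq_of_mem_parts (e j).2 (e j').2 h h'))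

variable [Fintype ι]

/-- The labels of the blocks of `π` that are contained in `C`. -/
def labels (C : Finset α) : Finset ι := Finset.univ.filter fun j => (e j).1 ⊆ C

@[simp]
theorem mem_labels {C : Finset α} {j : ι} : j ∈ labels e C ↔ (e j).1 ⊆ C := by
  simp [labels]

theorem labels_mono {C D : Finset α} (h : C ⊆ D) : labels e C ⊆ labels e D := fun j hj => by
  rw [mem_labels] at hj ⊢
  exact hj.trans h

/-- `C` is a union of blocks of `π`, so its labels recover it; nothing of the kind is needed for
`D`. -/
theorem labels_subset_iff {σ : Finpartition N} (h : π ≤ σ) {C D : Finset α} (hC : C ∈ σ.parts) :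
    labels e C ⊆ labels e D ↔ C ⊆ D := by
  refine ⟨fun hl x hx => ?_, labels_mono e⟩
  obtain ⟨j, hj⟩ := exists_label e (σ.le hC hx)
  have h1 : (e j).1 ⊆ C := subset_of_le_of_mem h (e j).2 hC hj hx
  exact (mem_labels e).1 (hl ((mem_labels e).2 h1)) hj

/-- The union of the blocks with labels in `J`. -/
def unlabel (J : Finset ι) : Finset α := J.biUnion fun j => (e j).1

theorem labels_unlabel (J : Finset ι) : labels e (unlabel e J) = J := by
  ext j
  rw [mem_labels, unlabel]
  constructor
  · intro h
    obtain ⟨x, hx, -⟩ := exists_mem_label e j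
    obtain ⟨j', hj', hx'⟩ := Finset.mem_biUnion.1 (h hx)
    rwa [label_unique e hx hx']
  · exact fun h => Finset.subset_biUnion_of_mem (fun j => (e j).1) h

variable [DecidableEq ι]

/-- The partition of the labels of the blocks of `π` that is induced by `σ ≥ π`. -/
def relabel (σ : Finpartition N) (h : π ≤ σ) : Finpartition (Finset.univ : Finset ι) :=
  ofExistsUnique (σ.parts.image (labels e)) (fun _ _ => Finset.subset_univ _)
    (by
      intro j _
      obtain ⟨C, hC, hjC⟩ := h (e j).2
      refine ⟨labels e C, ⟨Finset.mem_image_of_mem _ hC, (mem_labels e).2 hjC⟩, ?_⟩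
      rintro J ⟨hJ, hjJ⟩
      obtain ⟨D, hD, rfl⟩ := Finset.mem_image.1 hJ
      obtain ⟨x, hx, -⟩ := exists_mem_label e j
      rw [σ.eq_of_mem_parts hD hC ((mem_labels e).1 hjJ hx) (hjC hx)])
    (by
      intro h0
      obtain ⟨C, hC, hC0⟩ := Finset.mem_image.1 h0
      obtain ⟨B, hB, hBC⟩ := exists_le_of_le h hC
      have : e.symm ⟨B, hB⟩ ∈ labels e C := (mem_labels e).2 (by simpa using hBC)
      simp [hC0] at this)

@[simp]
theorem relabel_parts (σ : Finpartition N) (h : π ≤ σ) :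
    (relabel e σ h).parts = σ.parts.image (labels e) := rfl

theorem relabel_le_relabel_iff {σ τ : Finpartition N} (hσ : π ≤ σ) (hτ : π ≤ τ) :
    relabel e σ hσ ≤ relabel e τ hτ ↔ σ ≤ τ := by
  constructor
  · intro h C hC
    obtain ⟨J, hJ, hle⟩ := h (Finset.mem_image_of_mem (labels e) hC)
    obtain ⟨D, hD, rfl⟩ := Finset.mem_image.1 hJ
    exact ⟨D, hD, (labels_subset_iff e hσ hC).1 hle⟩
  · intro h J hJ
    obtain ⟨C, hC, rfl⟩ := Finset.mem_image.1 hJ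
    obtain ⟨D, hD, hCD⟩ := h hC
    exact ⟨labels e D, Finset.mem_image_of_mem _ hD, labels_mono e hCD⟩

/-- Replacing each class of labels by the union of its blocks inverts `relabel`. -/
theorem exists_relabel_eq (τ : Finpartition (Finset.univ : Finset ι)) :
    ∃ (σ : Finpartition N) (h : π ≤ σ), σ.parts = τ.parts.image (unlabel e) ∧
      relabel e σ h = τ := by
  have hN : ∀ J : Finset ι, unlabel e J ⊆ N := fun J =>
    Finset.biUnion_subset.2 fun j _ => π.le (e j).2
  let σ : Finpartition N := ofExistsUnique (τ.parts.image (unlabel e))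
    (by
      intro C hC
      obtain ⟨J, -, rfl⟩ := Finset.mem_image.1 hC
      exact hN J)
    (by
      intro x hx
      obtain ⟨j, hj⟩ := exists_label e hx
      obtain ⟨J, hJ, hjJ⟩ := τ.exists_mem (Finset.mem_univ j)
      refine ⟨unlabel e J, ⟨Finset.mem_image_of_mem _ hJ,
        Finset.mem_biUnion.2 ⟨j, hjJ, hj⟩⟩, ?_⟩
      rintro C ⟨hC, hxC⟩
      obtain ⟨J', hJ', rfl⟩ := Finset.mem_image.1 hC
      obtain ⟨j', hj', hxj'⟩ := Finset.mem_biUnion.1 hxC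
      rw [label_unique e hj hxj'] at hjJ
      rw [τ.eq_of_mem_parts hJ hJ' hjJ hj'])
    (by
      intro h0
      obtain ⟨J, hJ, hJ0⟩ := Finset.mem_image.1 h0
      have h1 := labels_unlabel e J
      obtain ⟨j, hj⟩ := τ.nonempty_of_mem_parts hJ
      rw [hJ0] at h1
      rw [← h1, mem_labels] at hj
      exact π.ne_empty (e j).2 (Finset.subset_empty.1 hj))
  have hπσ : π ≤ σ := by
    intro B hB
    obtain ⟨J, hJ, hjJ⟩ := τ.exists_mem (Finset.mem_univ (e.symm ⟨B, hB⟩))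
    refine ⟨unlabel e J, Finset.mem_image_of_mem _ hJ, ?_⟩
    have := Finset.subset_biUnion_of_mem (fun j => (e j).1) hjJ
    simpa [unlabel] using this
  refine ⟨σ, hπσ, rfl, Finpartition.ext ?_⟩
  have : σ.parts = τ.parts.image (unlabel e) := rfl
  rw [relabel_parts, this, Finset.image_image]
  have h2 : labels e ∘ unlabel e = id := funext fun J => labels_unlabel e J
  rw [h2, Finset.image_id]

end Finpartition

namespace EmbeddedSubset

variable {α ι : Type*} [DecidableEq α] [Fintype ι] [DecidableEq ι] {N : Finset α}
  {P' : EmbeddedSubset N} (e : ι ≃ {T : Finset α // T ∈ P'.part.parts})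

open Finpartition

/-- The image of `P ≥ P'` under a labelling of the blocks of `P'`. -/
def labelled (P : EmbeddedSubset N) (h : P' ≤ P) :
    EmbeddedSubset (Finset.univ : Finset ι) where
  block := labels e P.block
  part := Finpartition.relabel e P.part h.2
  mem := Finset.mem_image_of_mem _ P.mem

theorem labelled_le_labelled_iff {P Q : EmbeddedSubset N} (hP : P' ≤ P) (hQ : P' ≤ Q) :
    labelled e P hP ≤ labelled e Q hQ ↔ P ≤ Q :=
  and_congr (labels_subset_iff e hP.2 P.mem) (Finpartition.relabel_le_relabel_iff e hP.2 hQ.2)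

theorem atom_le_labelled {P : EmbeddedSubset N} (hP : P' ≤ P) :
    atom (e.symm ⟨P'.block, P'.mem⟩) (Finset.mem_univ _) ≤ labelled e P hP := by
  rw [atom_le, labelled, mem_labels]
  simpa using hP.1

theorem exists_labelled_eq {Q : EmbeddedSubset (Finset.univ : Finset ι)}
    (hQ : atom (e.symm ⟨P'.block, P'.mem⟩) (Finset.mem_univ _) ≤ Q) :
    ∃ (P : EmbeddedSubset N) (h : P' ≤ P), labelled e P h = Q := by
  obtain ⟨σ, hσ, hparts, hrel⟩ := Finpartition.exists_relabel_eq e Q.part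
  refine ⟨⟨unlabel e Q.block, σ, hparts ▸ Finset.mem_image_of_mem _ Q.mem⟩, ⟨?_, hσ⟩, ?_⟩
  · have h1 := (atom_le _).1 hQ
    have := Finset.subset_biUnion_of_mem (fun j => (e j).1) h1
    simpa [unlabel] using this
  · exact EmbeddedSubset.ext (labels_unlabel e _) hrel

theorem nonempty_Icc_orderIso_labelled {P : EmbeddedSubset N} (h : P' ≤ P) :
    Nonempty (Set.Icc P' P ≃o
      Set.Icc (atom (e.symm ⟨P'.block, P'.mem⟩) (Finset.mem_univ _)) (labelled e P h)) := by
  refine nonempty_orderIso_of_surjective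
    (fun R => ⟨labelled e R.1 R.2.1, atom_le_labelled e R.2.1,
      (labelled_le_labelled_iff e R.2.1 h).2 R.2.2⟩)
    (fun R T => labelled_le_labelled_iff e R.2.1 T.2.1) ?_
  rintro ⟨Q, hQ, hQP⟩
  obtain ⟨R, hR, rfl⟩ := exists_labelled_eq e hQ
  exact ⟨⟨R, hR, (labelled_le_labelled_iff e hR h).1 hQP⟩, rfl⟩

end EmbeddedSubset

namespace EmbLattice

variable {α : Type*} [DecidableEq α] {N : Finset α}

open EmbeddedSubset

theorem nonempty_Icc_orderIso_labelled {ι : Type*} [Fintype ι] [DecidableEq ι]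
    {P' : EmbeddedSubset N} (e : ι ≃ {T : Finset α // T ∈ P'.part.parts})
    {P : EmbeddedSubset N} (h : P' ≤ P) :
    Nonempty (Set.Icc (P' : EmbLattice N) P ≃o
      Set.Icc ((atom (e.symm ⟨P'.block, P'.mem⟩) (Finset.mem_univ _) :
        EmbeddedSubset (Finset.univ : Finset ι)) : EmbLattice (Finset.univ : Finset ι))
        ((labelled e P h : EmbeddedSubset (Finset.univ : Finset ι)) :
          EmbLattice (Finset.univ : Finset ι))) := by
  obtain ⟨f⟩ := WithBot.nonempty_Icc_coe_orderIso P' P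
  obtain ⟨g⟩ := EmbeddedSubset.nonempty_Icc_orderIso_labelled e h
  obtain ⟨k⟩ := WithBot.nonempty_Icc_coe_orderIso
    (atom (e.symm ⟨P'.block, P'.mem⟩) (Finset.mem_univ _)) (labelled e P h)
  exact ⟨(f.trans g).trans k.symm⟩

/-- Forgetting the distinguished block loses nothing above `P`, by `le_of_part_le`; `coarsen`
restores it. -/
theorem nonempty_Icc_top_orderIso (P : EmbeddedSubset N) :
    Nonempty (Set.Icc (P : EmbLattice N) ⊤ ≃o Set.Ici P.part) := by
  rw [top_eq P.nonempty_ground]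
  obtain ⟨f⟩ := WithBot.nonempty_Icc_coe_orderIso P (whole P.nonempty_ground)
  obtain ⟨g⟩ := nonempty_orderIso_of_surjective
    (fun R : Set.Icc P (whole P.nonempty_ground) => (⟨R.1.part, R.2.1.2⟩ : Set.Ici P.part))
    (fun R T => ⟨fun h => le_of_part_le R.2.1 T.2.1 h, fun h => h.2⟩) (by
      rintro ⟨σ, hσ⟩
      exact ⟨⟨P.coarsen σ hσ, le_coarsen P σ hσ, le_whole _ _⟩, rfl⟩)
  exact ⟨f.trans g⟩

theorem nonempty_Icc_atom_top_orderIso {i : α} (hi : i ∈ N) :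
    Nonempty (Set.Icc ((atom i hi : EmbeddedSubset N) : EmbLattice N) ⊤ ≃o Finpartition N) := by
  obtain ⟨f⟩ := nonempty_Icc_top_orderIso (atom i hi)
  obtain ⟨g⟩ := nonempty_orderIso_of_surjective
    (fun σ : Set.Ici (atom i hi).part => σ.1) (fun _ _ => Iff.rfl)
    (fun σ => ⟨⟨σ, (bot_le : (⊥ : Finpartition N) ≤ σ)⟩, rfl⟩)
  exact ⟨f.trans g⟩

theorem nonempty_Icc_top_orderIso_finpartition {ι : Type*} [Fintype ι] [DecidableEq ι]
    (P : EmbeddedSubset N) (e : ι ≃ {T : Finset α // T ∈ P.part.parts}) :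
    Nonempty (Set.Icc (P : EmbLattice N) ⊤ ≃o Finpartition (Finset.univ : Finset ι)) := by
  obtain ⟨f⟩ := nonempty_Icc_top_orderIso P
  obtain ⟨g⟩ := nonempty_orderIso_of_surjective
    (fun σ : Set.Ici P.part => Finpartition.relabel e σ.1 σ.2)
    (fun σ τ => Finpartition.relabel_le_relabel_iff e σ.2 τ.2) (fun τ => by
      obtain ⟨σ, hσ, -, h⟩ := Finpartition.exists_relabel_eq e τ
      exact ⟨⟨σ, hσ⟩, h⟩)
  exact ⟨f.trans g⟩

end EmbLattice

/-! ### Lower intervals as products over the blocks -/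

namespace Finpartition

variable {α : Type*} [DecidableEq α] {N : Finset α}

/-- The blocks of `σ ≤ π` contained in the block `T` of `π`, as a partition of `T`. -/
def below {π σ : Finpartition N} (h : σ ≤ π) {T : Finset α} (hT : T ∈ π.parts) :
    Finpartition T :=
  σ.ofSubset (Finset.filter_subset (· ⊆ T) σ.parts) (by
    ext x
    simp only [Finset.mem_sup, Finset.mem_filter, id]
    constructor
    · rintro ⟨B, ⟨-, hB⟩, hx⟩
      exact hB hx
    · intro hx
      obtain ⟨B, hB, hxB⟩ := σ.exists_mem (π.le hT hx)
      exact ⟨B, ⟨hB, subset_of_le_of_mem h hB hT hxB hx⟩, hxB⟩)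

theorem mem_below {π σ : Finpartition N} (h : σ ≤ π) {T : Finset α} (hT : T ∈ π.parts)
    {B : Finset α} : B ∈ (below h hT).parts ↔ B ∈ σ.parts ∧ B ⊆ T := by
  simp [below]

/-- Every block of `σ` or `τ` lies inside one block of `π`, so refinement can be tested block by
block. -/
theorem le_iff_below_le {π σ τ : Finpartition N} (hσ : σ ≤ π) (hτ : τ ≤ π) :
    σ ≤ τ ↔ ∀ T (hT : T ∈ π.parts), below hσ hT ≤ below hτ hT := by
  constructor
  · intro h T hT B hB
    obtain ⟨hB, hBT⟩ := (mem_below hσ hT).1 hB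
    obtain ⟨C, hC, hBC⟩ := h hB
    obtain ⟨x, hx⟩ := σ.nonempty_of_mem_parts hB
    exact ⟨C, (mem_below hτ hT).2 ⟨hC, subset_of_le_of_mem hτ hC hT (hBC hx) (hBT hx)⟩, hBC⟩
  · intro h B hB
    obtain ⟨T, hT, hBT⟩ := hσ hB
    obtain ⟨C, hC, hBC⟩ := h T hT ((mem_below hσ hT).2 ⟨hB, hBT⟩)
    exact ⟨C, ((mem_below hτ hT).1 hC).1, hBC⟩

theorem bind_le {π : Finpartition N} (Q : ∀ T ∈ π.parts, Finpartition T) : π.bind Q ≤ π := by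
  intro B hB
  obtain ⟨T, hT, hBT⟩ := mem_bind.1 hB
  exact ⟨T, hT, (Q T hT).le hBT⟩

theorem below_bind {π : Finpartition N} (Q : ∀ T ∈ π.parts, Finpartition T) {T : Finset α}
    (hT : T ∈ π.parts) : below (bind_le Q) hT = Q T hT := by
  symm
  refine ext_of_subset fun B hB => ?_
  exact (mem_below _ hT).2 ⟨mem_bind.2 ⟨T, hT, hB⟩, (Q T hT).le hB⟩

end Finpartition

namespace EmbLattice

variable {α : Type*} [DecidableEq α] {N : Finset α}

open Finpartition

theorem nonempty_Iic_orderIso (P : EmbeddedSubset N) :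
    Nonempty (Set.Iic P ≃o EmbeddedSubset P.block ×
      ((T : {T : Finset α // T ∈ P.part.parts.erase P.block}) → Finpartition T.1)) := by
  refine nonempty_orderIso_of_surjective (fun R : Set.Iic P =>
    (⟨R.1.block, below R.2.2 P.mem, (mem_below _ _).2 ⟨R.1.mem, R.2.1⟩⟩,
      fun T => below R.2.2 (Finset.mem_of_mem_erase T.2))) ?_ ?_
  · intro R R'
    change (R.1.block ⊆ R'.1.block ∧ below R.2.2 P.mem ≤ below R'.2.2 P.mem) ∧
      (∀ T : {T : Finset α // T ∈ P.part.parts.erase P.block},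
        below R.2.2 (Finset.mem_of_mem_erase T.2) ≤ below R'.2.2 (Finset.mem_of_mem_erase T.2)) ↔
      R.1.block ⊆ R'.1.block ∧ R.1.part ≤ R'.1.part
    rw [le_iff_below_le R.2.2 R'.2.2, and_assoc]
    refine and_congr Iff.rfl ⟨fun h T hT => ?_, fun h => ⟨h _ P.mem, fun T => h _ _⟩⟩
    by_cases hTP : T = P.block
    · subst hTP
      exact h.1
    · exact h.2 ⟨T, Finset.mem_erase.2 ⟨hTP, hT⟩⟩
  · rintro ⟨E, F⟩
    -- The partitions to be glued: `E.part` on the distinguished block, transported along the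
    -- equality of blocks, and `F` on the others.
    let Q : ∀ T ∈ P.part.parts, Finpartition T := fun T hT =>
      if h : P.block = T then E.part.copy h else F ⟨T, Finset.mem_erase.2 ⟨Ne.symm h, hT⟩⟩
    have hQ : Q P.block P.mem = E.part := by
      simp only [Q, dif_pos]
      rfl
    have hmem : E.block ∈ (P.part.bind Q).parts :=
      mem_bind.2 ⟨P.block, P.mem, by rw [hQ]; exact E.mem⟩
    refine ⟨⟨⟨E.block, P.part.bind Q, hmem⟩, E.part.le E.mem, bind_le Q⟩, ?_⟩
    refine Prod.ext (EmbeddedSubset.ext rfl ?_) (funext fun T => ?_)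
    · exact (below_bind Q P.mem).trans hQ
    · refine (below_bind Q (Finset.mem_of_mem_erase T.2)).trans ?_
      simp only [Q]
      rw [dif_neg (Finset.ne_of_mem_erase T.2).symm]

theorem nonempty_Icc_bot_orderIso (P : EmbeddedSubset N) :
    Nonempty (Set.Icc (⊥ : EmbLattice N) P ≃o WithBot (EmbeddedSubset P.block ×
      ((T : {T : Finset α // T ∈ P.part.parts.erase P.block}) → Finpartition T.1))) := by
  obtain ⟨f⟩ := WithBot.nonempty_Icc_bot_orderIso P
  obtain ⟨g⟩ := nonempty_Iic_orderIso P
  exact ⟨f.trans g.withBotCongr⟩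

end EmbLattice

/-! ### Stirling numbers and the number of elements -/

section Counting

variable {α : Type*} [DecidableEq α] {s N : Finset α}

/-- An embedded subset is a partition with a choice of one of its blocks. -/
theorem EmbeddedSubset.ncard_card_eq (k : ℕ) :
    {P : EmbeddedSubset N | P.part.parts.card = k}.ncard =
      k * {π : Finpartition N | π.parts.card = k}.ncard := by
  rw [← Nat.card_coe_set_eq, ← Nat.card_coe_set_eq]
  let e : {P : EmbeddedSubset N | P.part.parts.card = k} ≃
      Σ π : {π : Finpartition N | π.parts.card = k}, {T // T ∈ π.1.parts} :=
    { toFun := fun P => ⟨⟨P.1.part, P.2⟩, ⟨P.1.block, P.1.mem⟩⟩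
      invFun := fun x => ⟨⟨x.2.1, x.1.1, x.2.2⟩, x.1.2⟩
      left_inv := fun _ => rfl
      right_inv := fun _ => rfl }
  have := Fintype.ofFinite {π : Finpartition N | π.parts.card = k}
  rw [Nat.card_congr e, Nat.card_sigma, Finset.sum_congr rfl
    (g := fun _ => k) fun π _ => by rw [Nat.card_eq_fintype_card, Fintype.card_coe]; exact π.2]
  rw [Finset.sum_const, Finset.card_univ, Nat.card_eq_fintype_card, smul_eq_mul, mul_comm]

namespace Finpartition

/-- The partition of `insert a s` obtained from one of `s` by adding the block `{a}`. -/
def addSingleton {a : α} (ha : a ∉ s) (σ : Finpartition s) : Finpartition (insert a s) :=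
  σ.extend (b := {a}) (by simp) (by simpa using ha) (by
    rw [Finset.sup_eq_union, Finset.union_comm]; rfl)

theorem addSingleton_parts {a : α} (ha : a ∉ s) (σ : Finpartition s) :
    (σ.addSingleton ha).parts = insert {a} σ.parts := rfl

theorem notMem_of_mem_parts {a : α} (ha : a ∉ s) {σ : Finpartition s} {B : Finset α}
    (hB : B ∈ σ.parts) : a ∉ B := fun h => ha (σ.le hB h)

/-- The partition of `insert a s` obtained from an embedded subset of `s` by adding `a` to its
block. -/
def addToBlock {a : α} (ha : a ∉ s) (P : EmbeddedSubset s) : Finpartition (insert a s) :=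
  ofExistsUnique (insert (insert a P.block) (P.part.parts.erase P.block))
    (by
      intro B hB
      rcases Finset.mem_insert.1 hB with rfl | hB
      · exact Finset.insert_subset_insert _ (P.part.le P.mem)
      · exact (P.part.le (Finset.mem_of_mem_erase hB)).trans (Finset.subset_insert _ _))
    (by
      intro x hx
      rcases Finset.mem_insert.1 hx with rfl | hx
      · refine ⟨insert x P.block, by simp, ?_⟩
        rintro B ⟨hB, hxB⟩
        rcases Finset.mem_insert.1 hB with rfl | hB
        · rfl
        · exact absurd hxB (notMem_of_mem_parts ha (Finset.mem_of_mem_erase hB))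
      · obtain ⟨C, hC, hxC⟩ := P.part.exists_mem hx
        have hxa : x ≠ a := ne_of_mem_of_not_mem hx ha
        have key : ∀ D ∈ P.part.parts, x ∈ D → D = C :=
          fun D hD hxD => P.part.eq_of_mem_parts hD hC hxD hxC
        have hP := P.mem
        by_cases h : C = P.block
        · refine ⟨insert a P.block, ⟨by simp, by simp [← h, hxC]⟩, ?_⟩
          rintro D ⟨hD, hxD⟩
          grind
        · refine ⟨C, ⟨by simp [h, hC], hxC⟩, ?_⟩
          rintro D ⟨hD, hxD⟩
          grind)
    (by
      have := P.part.empty_notMem_parts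
      simp only [Finset.mem_insert, Finset.mem_erase]
      rintro (h | h)
      · exact Finset.insert_ne_empty _ _ h.symm
      · exact this h.2)

theorem addToBlock_parts {a : α} (ha : a ∉ s) (P : EmbeddedSubset s) :
    (addToBlock ha P).parts = insert (insert a P.block) (P.part.parts.erase P.block) := rfl

theorem card_addSingleton {a : α} (ha : a ∉ s) (σ : Finpartition s) :
    (σ.addSingleton ha).parts.card = σ.parts.card + 1 :=
  card_extend _ _ _

theorem card_addToBlock {a : α} (ha : a ∉ s) (P : EmbeddedSubset s) :
    (addToBlock ha P).parts.card = P.part.parts.card := by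
  rw [addToBlock_parts, Finset.card_insert_of_notMem, Finset.card_erase_add_one P.mem]
  intro h
  exact notMem_of_mem_parts ha (Finset.mem_of_mem_erase h) (Finset.mem_insert_self _ _)

theorem addSingleton_injective {a : α} (ha : a ∉ s) :
    Function.Injective (addSingleton ha) := by
  intro σ τ h
  have h1 := congrArg Finpartition.parts h
  rw [addSingleton_parts, addSingleton_parts] at h1
  have h2 : ∀ ρ : Finpartition s, {a} ∉ ρ.parts := fun ρ hρ =>
    notMem_of_mem_parts ha hρ (Finset.mem_singleton_self a)
  have h3 := congrArg (fun t => t.erase {a}) h1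
  simp only [Finset.erase_insert (h2 _)] at h3
  exact Finpartition.ext h3

theorem addToBlock_injective {a : α} (ha : a ∉ s) :
    Function.Injective (addToBlock ha) := by
  intro P Q h
  have h1 := congrArg Finpartition.parts h
  rw [addToBlock_parts, addToBlock_parts] at h1
  have h2 : ∀ (R : EmbeddedSubset s) (B : Finset α),
      insert a B ∉ R.part.parts.erase R.block := fun R B hR =>
    notMem_of_mem_parts ha (Finset.mem_of_mem_erase hR) (Finset.mem_insert_self a B)
  have h3 : insert a P.block = insert a Q.block := by
    have h4 : insert a P.block ∈ insert (insert a Q.block) (Q.part.parts.erase Q.block) :=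
      h1 ▸ Finset.mem_insert_self _ _
    exact (Finset.mem_insert.1 h4).resolve_right (h2 Q _)
  have h5 : P.block = Q.block := by
    rw [← Finset.erase_insert (notMem_of_mem_parts ha P.mem), h3,
      Finset.erase_insert (notMem_of_mem_parts ha Q.mem)]
  refine EmbeddedSubset.ext h5 (Finpartition.ext ?_)
  have h6 := congrArg (fun t => t.erase (insert a P.block)) h1
  rw [h3] at h6
  simp only [Finset.erase_insert (h2 _ _)] at h6
  rw [← Finset.insert_erase P.mem, h6, h5, Finset.insert_erase Q.mem]

/-- The case distinction is whether the block containing `a` is `{a}`; otherwise erasing `a` leaves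
a nonempty block to distinguish. -/
theorem exists_add_eq {a : α} (ha : a ∉ s) (π : Finpartition (insert a s)) :
    (∃ σ, addSingleton ha σ = π) ∨ ∃ P, addToBlock ha P = π := by
  obtain ⟨B, hB, haB⟩ := π.exists_mem (Finset.mem_insert_self a s)
  have huniq : ∀ C ∈ π.parts, ∀ D ∈ π.parts, ∀ x ∈ C, x ∈ D → C = D :=
    fun C hC D hD x hxC hxD => π.eq_of_mem_parts hC hD hxC hxD
  have hsub : ∀ C ∈ π.parts, C ≠ B → C ⊆ s := by
    intro C hC hCB x hx
    rcases Finset.mem_insert.1 (π.le hC hx) with rfl | h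
    · exact absurd (huniq C hC B hB x hx haB) hCB
    · exact h
  have hBs : B.erase a ⊆ s := fun x hx =>
    (Finset.mem_insert.1 (π.le hB (Finset.mem_of_mem_erase hx))).resolve_left
      (Finset.ne_of_mem_erase hx)
  have h0 := π.empty_notMem_parts
  by_cases hBa : B = {a}
  · left
    let σ : Finpartition s := ofExistsUnique (π.parts.erase B)
      (fun C hC => hsub C (Finset.mem_of_mem_erase hC) (Finset.ne_of_mem_erase hC))
      (by
        intro x hx
        obtain ⟨C, hC, hxC⟩ := π.exists_mem (Finset.mem_insert_of_mem hx)
        refine ⟨C, ⟨Finset.mem_erase.2 ⟨?_, hC⟩, hxC⟩, fun D hD =>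
          huniq D (Finset.mem_of_mem_erase hD.1) C hC x hD.2 hxC⟩
        rintro rfl
        rw [hBa, Finset.mem_singleton] at hxC
        exact ha (hxC ▸ hx))
      (fun h => h0 (Finset.mem_of_mem_erase h))
    refine ⟨σ, Finpartition.ext ?_⟩
    rw [addSingleton_parts, ← hBa]
    exact Finset.insert_erase hB
  · right
    have hne : (B.erase a).Nonempty := by
      rw [Finset.nonempty_iff_ne_empty]
      exact fun h => hBa ((Finset.erase_eq_empty_iff _ _).1 h |>.resolve_left
        (Finset.ne_empty_of_mem haB))
    let σ : Finpartition s := ofExistsUnique (insert (B.erase a) (π.parts.erase B))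
      (by
        intro C hC
        rcases Finset.mem_insert.1 hC with rfl | hC
        · exact hBs
        · exact hsub C (Finset.mem_of_mem_erase hC) (Finset.ne_of_mem_erase hC))
      (by
        intro x hx
        obtain ⟨C, hC, hxC⟩ := π.exists_mem (Finset.mem_insert_of_mem hx)
        have hxa : x ≠ a := ne_of_mem_of_not_mem hx ha
        by_cases hCB : C = B
        · refine ⟨B.erase a, ⟨by simp, Finset.mem_erase.2 ⟨hxa, hCB ▸ hxC⟩⟩, ?_⟩
          rintro D ⟨hD, hxD⟩
          rcases Finset.mem_insert.1 hD with rfl | hD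
          · rfl
          · exact absurd ((huniq D (Finset.mem_of_mem_erase hD) C hC x hxD hxC).trans hCB)
              (Finset.ne_of_mem_erase hD)
        · refine ⟨C, ⟨by simp [hCB, hC], hxC⟩, ?_⟩
          rintro D ⟨hD, hxD⟩
          rcases Finset.mem_insert.1 hD with rfl | hD
          · exact absurd (huniq C hC B hB x hxC (Finset.mem_of_mem_erase hxD)) hCB
          · exact huniq D (Finset.mem_of_mem_erase hD) C hC x hxD hxC)
      (by
        intro h
        rcases Finset.mem_insert.1 h with h | h
        · exact hne.ne_empty h.symm
        · exact h0 (Finset.mem_of_mem_erase h))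
    have hnot : B.erase a ∉ π.parts.erase B := by
      intro h
      obtain ⟨x, hx⟩ := hne
      exact Finset.ne_of_mem_erase h (huniq _ (Finset.mem_of_mem_erase h) B hB x hx
        (Finset.mem_of_mem_erase hx))
    refine ⟨⟨B.erase a, σ, Finset.mem_insert_self _ _⟩, Finpartition.ext ?_⟩
    rw [addToBlock_parts]
    change insert (insert a (B.erase a))
      ((insert (B.erase a) (π.parts.erase B)).erase (B.erase a)) = π.parts
    rw [Finset.insert_erase haB, Finset.erase_insert hnot, Finset.insert_erase hB]

/-- The Stirling recursion. The factor `k + 1` counts the blocks that `a` may join, through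
`EmbeddedSubset.ncard_card_eq`. -/
theorem ncard_insert {a : α} (ha : a ∉ s) (k : ℕ) :
    {π : Finpartition (insert a s) | π.parts.card = k + 1}.ncard =
      (k + 1) * {π : Finpartition s | π.parts.card = k + 1}.ncard +
        {π : Finpartition s | π.parts.card = k}.ncard := by
  have h : {π : Finpartition (insert a s) | π.parts.card = k + 1} =
      addToBlock ha '' {P | P.part.parts.card = k + 1} ∪
        addSingleton ha '' {σ | σ.parts.card = k} := by
    ext π
    constructor
    · intro hπ
      rcases exists_add_eq ha π with ⟨σ, rfl⟩ | ⟨P, rfl⟩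
      · exact Or.inr ⟨σ, by simpa [card_addSingleton] using hπ, rfl⟩
      · exact Or.inl ⟨P, by simpa [card_addToBlock] using hπ, rfl⟩
    · rintro (⟨P, hP, rfl⟩ | ⟨σ, hσ, rfl⟩)
      · simpa [card_addToBlock] using hP
      · simpa [card_addSingleton] using hσ
  rw [h, Set.ncard_union_eq _ (Set.toFinite _) (Set.toFinite _),
    Set.ncard_image_of_injective _ (addToBlock_injective ha),
    Set.ncard_image_of_injective _ (addSingleton_injective ha), EmbeddedSubset.ncard_card_eq]
  rw [Set.disjoint_left]
  rintro _ ⟨P, -, rfl⟩ ⟨σ, -, hσ⟩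
  have h1 : {a} ∈ (addToBlock ha P).parts := by
    rw [← hσ, addSingleton_parts]
    exact Finset.mem_insert_self _ _
  rw [addToBlock_parts] at h1
  rcases Finset.mem_insert.1 h1 with h2 | h2
  · obtain ⟨x, hx⟩ := P.block_nonempty
    have h3 : x ∈ ({a} : Finset α) := h2 ▸ Finset.mem_insert_of_mem hx
    rw [Finset.mem_singleton] at h3
    exact notMem_of_mem_parts ha P.mem (h3 ▸ hx)
  · exact notMem_of_mem_parts ha (Finset.mem_of_mem_erase h2) (Finset.mem_singleton_self a)

/-- The Stirling numbers of the second kind count partitions by their number of blocks. -/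
theorem ncard_card_eq_stirlingSecond (s : Finset α) (k : ℕ) :
    {π : Finpartition s | π.parts.card = k}.ncard = Nat.stirlingSecond s.card k := by
  induction s using Finset.induction_on generalizing k with
  | empty =>
    have h : ∀ π : Finpartition (∅ : Finset α), π.parts = ∅ := fun π =>
      Finpartition.parts_eq_empty_iff.2 rfl
    cases k with
    | zero =>
      have : {π : Finpartition (∅ : Finset α) | π.parts.card = 0} = {⊥} := by
        ext π
        simp only [h, Finset.card_empty, Set.mem_ofPred_eq, Set.mem_singleton_iff, true_iff]
        exact Finpartition.ext (by rw [h, h])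
      rw [this, Set.ncard_singleton]
      rfl
    | succ k =>
      simp [h]
  | insert a s ha ih =>
    rw [Finset.card_insert_of_notMem ha]
    cases k with
    | zero =>
      rw [Nat.stirlingSecond_succ_zero, Set.ncard_eq_zero (Set.toFinite _),
        Set.eq_empty_iff_forall_notMem]
      intro π hπ
      have := Finpartition.parts_eq_empty_iff.1 (Finset.card_eq_zero.1 hπ)
      exact Finset.insert_ne_empty _ _ this
    | succ k => rw [ncard_insert ha, ih, ih, Nat.stirlingSecond_succ_succ]

end Finpartition

/-- The upper bound on `k` makes the truncated `N.card - k` determine `k`; the `+ 1` excludes `⊥`.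
-/
theorem EmbLattice.ncard_height_eq {k : ℕ} (hk : k ∈ Finset.Icc 1 N.card) :
    {x : EmbLattice N | Order.height x = ((N.card - k + 1 : ℕ) : ℕ∞)}.ncard =
      k * Nat.stirlingSecond N.card k := by
  rw [← Finpartition.ncard_card_eq_stirlingSecond, ← EmbeddedSubset.ncard_card_eq,
    ← Set.ncard_image_of_injective _ (WithBot.coe_injective (α := EmbeddedSubset N))]
  congr 1
  ext x
  simp only [Set.mem_ofPred_eq, EmbLattice.height_eq_rank, Nat.cast_inj, Set.mem_image]
  rw [Finset.mem_Icc] at hk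
  induction x using WithBot.recBotCoe with
  | bot => simp
  | coe P =>
    have h1 := P.part.card_parts_le_card
    simp only [EmbLattice.rank_coe, WithBot.coe_inj, exists_eq_right]
    omega

theorem EmbLattice.card_eq :
    Nat.card (EmbLattice N) =
      ∑ k ∈ Finset.Icc 1 N.card, k * Nat.stirlingSecond N.card k + 1 := by
  have h1 : Nat.card (EmbLattice N) = Nat.card (EmbeddedSubset N) + 1 := Finite.card_option
  have := Fintype.ofFinite (EmbeddedSubset N)
  rw [h1, Nat.card_eq_fintype_card, ← Finset.card_univ,
    Finset.card_eq_sum_card_fiberwise (f := fun P => P.part.parts.card)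
      (t := Finset.Icc 1 N.card)]
  · congr 1
    refine Finset.sum_congr rfl fun k _ => ?_
    rw [← Finpartition.ncard_card_eq_stirlingSecond, ← EmbeddedSubset.ncard_card_eq,
      ← Set.ncard_coe_finset]
    congr 1
    ext P
    simp
  · intro P _
    have h1 := P.part.card_parts_le_card
    have h2 := P.card_parts_pos
    simp only [Finset.coe_Icc, Set.mem_Icc]
    omega

end Counting

/-! ### Upper covers and the number of maximal chains -/

namespace Finpartition

variable {α : Type*} [DecidableEq α] {N : Finset α} {π : Finpartition N}

theorem card_filter_merge_add_one {A B X : Finset α} (hA : A ∈ π.parts) (hB : B ∈ π.parts)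
    (hAB : A ≠ B) (h : A ∪ B ⊆ X) :
    ((π.merge hA hB).parts.filter (· ⊆ X)).card + 1 = (π.parts.filter (· ⊆ X)).card := by
  have h1 := union_notMem_parts hA hB hAB
  have hA' : A ∈ π.parts.filter (· ⊆ X) :=
    Finset.mem_filter.2 ⟨hA, Finset.subset_union_left.trans h⟩
  have hB' : B ∈ (π.parts.filter (· ⊆ X)).erase A :=
    Finset.mem_erase.2 ⟨hAB.symm, Finset.mem_filter.2 ⟨hB, Finset.subset_union_right.trans h⟩⟩
  rw [merge_parts, Finset.filter_insert, if_pos h, Finset.filter_erase, Finset.filter_erase,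
    Finset.card_insert_of_notMem (by grind), Finset.card_erase_add_one hB',
    Finset.card_erase_add_one hA']

theorem filter_merge_of_not_subset {A B X : Finset α} (hA : A ∈ π.parts) (hB : B ∈ π.parts)
    (hAX : ¬ A ⊆ X) (hBX : ¬ B ⊆ X) :
    (π.merge hA hB).parts.filter (· ⊆ X) = π.parts.filter (· ⊆ X) := by
  have h : ¬ A ∪ B ⊆ X := fun h => hAX (Finset.subset_union_left.trans h)
  rw [merge_parts, Finset.filter_insert, if_neg h, Finset.filter_erase, Finset.filter_erase,
    Finset.erase_eq_of_notMem, Finset.erase_eq_of_notMem]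
  · simp [hAX]
  · simp [hBX]

/-- Each block of `π` lies in exactly one block of `σ`. -/
theorem sum_card_filter_subset {σ : Finpartition N} (h : π ≤ σ) :
    ∑ T ∈ σ.parts, (π.parts.filter (· ⊆ T)).card = π.parts.card := by
  rw [← Finset.card_biUnion]
  · congr 1
    ext B
    simp only [Finset.mem_biUnion, Finset.mem_filter]
    constructor
    · rintro ⟨T, -, hB, -⟩
      exact hB
    · intro hB
      obtain ⟨T, hT, hBT⟩ := h hB
      exact ⟨T, hT, hB, hBT⟩
  · intro T hT T' hT' hne
    rw [Function.onFun, Finset.disjoint_left]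
    intro B hB hB'
    rw [Finset.mem_filter] at hB hB'
    obtain ⟨x, hx⟩ := π.nonempty_of_mem_parts hB.1
    exact hne (σ.eq_of_mem_parts hT hT' (hB.2 hx) (hB'.2 hx))

theorem filter_subset_self {T : Finset α} (hT : T ∈ π.parts) :
    π.parts.filter (· ⊆ T) = {T} := by
  ext B
  simp only [Finset.mem_filter, Finset.mem_singleton]
  constructor
  · rintro ⟨hB, hBT⟩
    obtain ⟨x, hx⟩ := π.nonempty_of_mem_parts hB
    exact π.eq_of_mem_parts hB hT hx (hBT hx)
  · rintro rfl
    exact ⟨hT, subset_rfl⟩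

theorem card_filter_bot_subset {T : Finset α} (hT : T ⊆ N) :
    ((⊥ : Finpartition N).parts.filter (· ⊆ T)).card = T.card := by
  rw [← Finset.card_image_of_injective T (Finset.singleton_injective (α := α))]
  congr 1
  ext B
  simp only [Finset.mem_filter, mem_bot_iff, Finset.mem_image]
  constructor
  · rintro ⟨⟨a, -, rfl⟩, ha⟩
    exact ⟨a, Finset.singleton_subset_iff.1 ha, rfl⟩
  · rintro ⟨a, ha, rfl⟩
    exact ⟨⟨a, hT ha, rfl⟩, Finset.singleton_subset_iff.2 ha⟩

end Finpartition

namespace EmbeddedSubset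

variable {α : Type*} [DecidableEq α] {N : Finset α}

open Finpartition

/-- A cover of `P` is determined by the pair of blocks that it loses. The restriction to `W` lets
the chain count sort covers by the block of the upper element in which the merge takes place. -/
theorem ncard_covBy_sdiff_subset (P : EmbeddedSubset N) {W : Finset (Finset α)}
    (hW : W ⊆ P.part.parts) :
    {Q | P ⋖ Q ∧ P.part.parts \ Q.part.parts ⊆ W}.ncard = W.card.choose 2 := by
  rw [← Finset.card_powersetCard, ← Set.ncard_coe_finset]
  refine Set.ncard_congr (fun Q _ => P.part.parts \ Q.part.parts) ?_ ?_ ?_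
  · rintro Q ⟨hQ, hQW⟩
    obtain ⟨A, B, hA, hB, hAB, h⟩ := exists_part_eq_merge hQ
    rw [Finset.mem_coe, Finset.mem_powersetCard]
    refine ⟨hQW, ?_⟩
    rw [h, sdiff_parts_merge hA hB hAB, Finset.card_pair hAB]
  · rintro Q Q' ⟨hQ, -⟩ ⟨hQ', -⟩ h
    obtain ⟨A, B, hA, hB, hAB, h1⟩ := exists_part_eq_merge hQ
    obtain ⟨A', B', hA', hB', hAB', h2⟩ := exists_part_eq_merge hQ'
    simp only [h1, h2, sdiff_parts_merge _ _ hAB, sdiff_parts_merge _ _ hAB'] at h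
    have h3 : Q.part = Q'.part := by
      rw [h1, h2]
      refine Finpartition.ext ?_
      have h' := congrArg (fun t : Finset (Finset α) => (t : Set (Finset α))) h
      simp only [Finset.coe_pair] at h'
      rcases Set.pair_eq_pair_iff.1 h' with ⟨rfl, rfl⟩ | ⟨rfl, rfl⟩
      · rfl
      · rw [merge_parts, merge_parts, Finset.union_comm, Finset.erase_right_comm]
    exact le_antisymm (le_of_part_le hQ.le hQ'.le h3.le) (le_of_part_le hQ'.le hQ.le h3.ge)
  · intro U hU
    rw [Finset.mem_coe, Finset.mem_powersetCard] at hU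
    obtain ⟨A, B, hAB, rfl⟩ := Finset.card_eq_two.1 hU.2
    have hA : A ∈ P.part.parts := hW (hU.1 (by simp))
    have hB : B ∈ P.part.parts := hW (hU.1 (by simp))
    have h := sdiff_parts_merge hA hB hAB
    exact ⟨_, ⟨covBy_coarsen_merge P hA hB hAB, by rw [coarsen_part, h]; exact hU.1⟩, h⟩

theorem ncard_covBy (P : EmbeddedSubset N) :
    {Q | P ⋖ Q}.ncard = P.part.parts.card.choose 2 := by
  rw [← ncard_covBy_sdiff_subset P subset_rfl]
  congr 1
  ext Q
  simp

theorem numMaxChains_coe (P' P : EmbeddedSubset N) :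
    numMaxChains (P' : EmbLattice N) P = numMaxChains P' P := by
  obtain ⟨f⟩ := WithBot.nonempty_Icc_coe_orderIso P' P
  exact Nat.card_congr (Flag.map f)

/-- Induction on the lower end, summing over its covers below `P`, grouped by the block `T` of `P`
that contains the two merged blocks. -/
theorem numMaxChains_eq {P' P : EmbeddedSubset N} (h : P' ≤ P) :
    (numMaxChains P' P : ℚ) =
      ((P'.part.parts.card - P.part.parts.card).factorial : ℚ)
          / 2 ^ (P'.part.parts.card - P.part.parts.card)
        * ∏ T ∈ P.part.parts, ((P'.part.parts.filter (· ⊆ T)).card.factorial : ℚ) := by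
  induction P' using (wellFounded_gt (α := EmbeddedSubset N)).induction with
  | _ P' ih =>
  rcases h.eq_or_lt with rfl | hlt
  · rw [numMaxChains_self, Finset.prod_eq_one fun T hT => by
      rw [filter_subset_self hT, Finset.card_singleton, Nat.factorial_one, Nat.cast_one]]
    simp
  classical
  set l : Finset α → ℕ := fun T => (P'.part.parts.filter (· ⊆ T)).card with hl
  set p : ℚ := ∏ T ∈ P.part.parts, ((l T).factorial : ℚ) with hp
  obtain ⟨d, hd⟩ : ∃ d, P'.part.parts.card = P.part.parts.card + d + 1 :=
    ⟨P'.part.parts.card - P.part.parts.card - 1, by have := card_lt_of_lt hlt; omega⟩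
  have hd1 : P'.part.parts.card - P.part.parts.card = d + 1 := by omega
  -- `c T` collects the covers of `P'` that merge two blocks inside `T`.
  let c : Finset α → Finset (EmbeddedSubset N) := fun T =>
    (Set.toFinite {Q | P' ⋖ Q ∧ P'.part.parts \ Q.part.parts ⊆
      P'.part.parts.filter (· ⊆ T)}).toFinset
  have hc : ∀ T Q, Q ∈ c T ↔ P' ⋖ Q ∧
      P'.part.parts \ Q.part.parts ⊆ P'.part.parts.filter (· ⊆ T) := fun T Q => by simp [c]
  have hcard : ∀ T, (c T).card = (l T).choose 2 := fun T => by
    rw [← Set.ncard_eq_toFinset_card _ (Set.toFinite _)]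
    exact ncard_covBy_sdiff_subset P' (Finset.filter_subset _ _)
  have hmerge : ∀ T Q, Q ∈ c T → ∃ (A B : Finset α) (hA : A ∈ P'.part.parts)
      (hB : B ∈ P'.part.parts), A ≠ B ∧ Q.part = P'.part.merge hA hB ∧ A ⊆ T ∧ B ⊆ T := by
    intro T Q hQ
    obtain ⟨h1, h2⟩ := (hc T Q).1 hQ
    obtain ⟨A, B, hA, hB, hAB, h3⟩ := exists_part_eq_merge h1
    rw [h3, sdiff_parts_merge hA hB hAB] at h2
    exact ⟨A, B, hA, hB, hAB, h3, (Finset.mem_filter.1 (h2 (by simp))).2,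
      (Finset.mem_filter.1 (h2 (by simp))).2⟩
  have hle : ∀ T ∈ P.part.parts, ∀ Q ∈ c T, Q ≤ P := by
    intro T hT Q hQ
    obtain ⟨A, B, hA, hB, -, h3, hAT, hBT⟩ := hmerge T Q hQ
    refine le_of_part_le ((hc T Q).1 hQ).1.le h ?_
    rw [h3]
    exact (merge_le_iff hA hB).2 ⟨h.2, T, hT, Finset.union_subset hAT hBT⟩
  have hcov : ∀ Q, Q ∈ P.part.parts.biUnion c ↔ P' ⋖ Q ∧ Q ≤ P := by
    intro Q
    rw [Finset.mem_biUnion]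
    constructor
    · rintro ⟨T, hT, hQ⟩
      exact ⟨((hc T Q).1 hQ).1, hle T hT Q hQ⟩
    · rintro ⟨h1, h2⟩
      obtain ⟨A, B, hA, hB, hAB, h3⟩ := exists_part_eq_merge h1
      have h4 := h2.2
      rw [h3] at h4
      obtain ⟨-, T, hT, hABT⟩ := (merge_le_iff hA hB).1 h4
      refine ⟨T, hT, (hc T Q).2 ⟨h1, ?_⟩⟩
      rw [h3, sdiff_parts_merge hA hB hAB]
      intro C hC
      rw [Finset.mem_insert, Finset.mem_singleton] at hC
      rcases hC with rfl | rfl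
      · exact Finset.mem_filter.2 ⟨hA, Finset.subset_union_left.trans hABT⟩
      · exact Finset.mem_filter.2 ⟨hB, Finset.subset_union_right.trans hABT⟩
  have hlpos : ∀ T ∈ P.part.parts, 0 < l T := fun T hT => by
    obtain ⟨B, hB, hBT⟩ := exists_le_of_le h.2 hT
    exact Finset.card_pos.2 ⟨B, Finset.mem_filter.2 ⟨hB, hBT⟩⟩
  -- Such a merge lowers `l T` by one and leaves the other factors unchanged, so the product of
  -- factorials is divided by `l T`.
  have hval : ∀ T ∈ P.part.parts, ∀ Q ∈ c T,
      (numMaxChains Q P : ℚ) = (d.factorial : ℚ) / 2 ^ d * (p / l T) := by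
    intro T hT Q hQ
    have h1 := ((hc T Q).1 hQ).1
    have h2 := card_of_covBy h1
    obtain ⟨A, B, hA, hB, hAB, h3, hAT, hBT⟩ := hmerge T Q hQ
    rw [ih Q h1.lt (hle T hT Q hQ)]
    have h4 : Q.part.parts.card - P.part.parts.card = d := by omega
    rw [h4]
    congr 1
    rw [eq_div_iff (Nat.cast_ne_zero.2 (hlpos T hT).ne'), hp,
      ← Finset.mul_prod_erase _ _ hT, ← Finset.mul_prod_erase _ _ hT]
    have h5 : (Q.part.parts.filter (· ⊆ T)).card + 1 = l T := by
      rw [h3]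
      exact card_filter_merge_add_one hA hB hAB (Finset.union_subset hAT hBT)
    have h6 : ∀ T' ∈ P.part.parts.erase T, Q.part.parts.filter (· ⊆ T') =
        P'.part.parts.filter (· ⊆ T') := by
      intro T' hT'
      have h7 : ∀ C ∈ P'.part.parts, C ⊆ T → ¬ C ⊆ T' := by
        intro C hC hCT hCT'
        obtain ⟨x, hx⟩ := P'.part.nonempty_of_mem_parts hC
        exact Finset.ne_of_mem_erase hT' (P.part.eq_of_mem_parts (Finset.mem_of_mem_erase hT') hT
          (hCT' hx) (hCT hx))
      rw [h3]
      exact filter_merge_of_not_subset hA hB (h7 A hA hAT) (h7 B hB hBT)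
    rw [Finset.prod_congr rfl fun T' hT' => by rw [h6 T' hT'], ← h5, Nat.factorial_succ]
    push_cast
    ring
  have hdisj : (P.part.parts : Set (Finset α)).PairwiseDisjoint c := by
    intro T hT T' hT' hne
    rw [Function.onFun, Finset.disjoint_left]
    intro Q hQ hQ'
    obtain ⟨A, B, hA, hB, hAB, h3, hAT, hBT⟩ := hmerge T Q hQ
    have h5 := ((hc T' Q).1 hQ').2
    rw [h3, sdiff_parts_merge hA hB hAB] at h5
    have h6 := (Finset.mem_filter.1 (h5 (Finset.mem_insert_self _ _))).2
    obtain ⟨x, hx⟩ := P'.part.nonempty_of_mem_parts hA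
    exact hne (P.part.eq_of_mem_parts hT hT' (hAT hx) (h6 hx))
  rw [numMaxChains_eq_sum hlt _ hcov, Finset.sum_biUnion hdisj]
  push_cast
  -- The binomial `l T * (l T - 1) / 2` cancels the division by `l T`. Summing `l T - 1` over `T`
  -- then gives the difference of the block counts, `d + 1`, which completes the factorial.
  have hterm : ∀ T ∈ P.part.parts, ∑ Q ∈ c T, (numMaxChains Q P : ℚ) =
      ((l T : ℚ) - 1) * ((d.factorial : ℚ) / 2 ^ (d + 1) * p) := by
    intro T hT
    rw [Finset.sum_congr rfl (hval T hT), Finset.sum_const, hcard, nsmul_eq_mul,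
      Nat.cast_choose_two]
    have : (l T : ℚ) ≠ 0 := Nat.cast_ne_zero.2 (hlpos T hT).ne'
    field_simp
    ring
  rw [Finset.sum_congr rfl hterm, ← Finset.sum_mul, Finset.sum_sub_distrib,
    ← Nat.cast_sum, sum_card_filter_subset h.2, hd1, hd, Nat.factorial_succ]
  simp only [Finset.sum_const, nsmul_eq_mul, mul_one]
  push_cast
  ring

end EmbeddedSubset

namespace EmbLattice

variable {α : Type*} [DecidableEq α] {N : Finset α}

open EmbeddedSubset

theorem ncard_covBy (P : EmbeddedSubset N) :
    {x : EmbLattice N | (P : EmbLattice N) ⋖ x}.ncard = P.part.parts.card.choose 2 := by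
  rw [← EmbeddedSubset.ncard_covBy, ← Set.ncard_image_of_injective _
    (WithBot.coe_injective (α := EmbeddedSubset N))]
  congr 1
  ext x
  induction x using WithBot.recBotCoe with
  | bot => simp [CovBy]
  | coe Q => simp [WithBot.coe_covBy_coe]

theorem numMaxChains_coe_coe {P' P : EmbeddedSubset N} (h : P' ≤ P) :
    (numMaxChains (P' : EmbLattice N) P : ℚ) =
      ((P'.part.parts.card - P.part.parts.card).factorial : ℚ)
          / 2 ^ (P'.part.parts.card - P.part.parts.card)
        * ∏ T ∈ P.part.parts, ((P'.part.parts.filter (· ⊆ T)).card.factorial : ℚ) := by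
  rw [numMaxChains_coe, numMaxChains_eq h]

theorem numMaxChains_coe_top (P : EmbeddedSubset N) :
    (numMaxChains (P : EmbLattice N) ⊤ : ℚ) =
      (P.part.parts.card.factorial : ℚ) * (P.part.parts.card - 1).factorial
        / 2 ^ (P.part.parts.card - 1) := by
  rw [top_eq P.nonempty_ground, numMaxChains_coe_coe (P.le_whole _)]
  have h : P.part.parts.filter (· ⊆ N) = P.part.parts :=
    Finset.filter_true_of_mem fun B hB => P.part.le hB
  simp only [whole, Finpartition.indiscrete_parts, Finset.card_singleton, Finset.prod_singleton, h]
  ring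

/-- The second element of a chain is one of the atoms at points of `P.block`. All of these
contribute equally, which gives the factor `P.block.card`. -/
theorem numMaxChains_bot_coe (P : EmbeddedSubset N) :
    (numMaxChains (⊥ : EmbLattice N) P : ℚ) =
      (P.block.card : ℚ) * (N.card - P.part.parts.card).factorial
          / 2 ^ (N.card - P.part.parts.card)
        * ∏ T ∈ P.part.parts, (T.card.factorial : ℚ) := by
  classical
  let a : {i // i ∈ P.block} → EmbLattice N := fun i =>
    ((atom i.1 (P.part.le P.mem i.2) : EmbeddedSubset N) : EmbLattice N)
  have ha : Function.Injective a := by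
    intro i j hij
    have h1 := congrArg EmbeddedSubset.block (WithBot.coe_inj.1 hij)
    exact Subtype.ext (Finset.singleton_injective h1)
  rw [numMaxChains_eq_sum (WithBot.bot_lt_coe P) (P.block.attach.image a),
    Finset.sum_image ha.injOn, Nat.cast_sum, Finset.sum_congr rfl fun i hi =>
      numMaxChains_coe_coe ((atom_le (P.part.le P.mem i.2)).2 i.2)]
  · have h : ∀ T ∈ P.part.parts, ((⊥ : Finpartition N).parts.filter (· ⊆ T)).card = T.card :=
      fun T hT => Finpartition.card_filter_bot_subset (P.part.le hT)
    simp only [atom, Finpartition.card_bot]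
    rw [Finset.prod_congr rfl fun T hT => by rw [h T hT], Finset.sum_const, Finset.card_attach,
      nsmul_eq_mul]
    ring
  · intro x
    rw [bot_covBy_iff, isAtom_iff, Finset.mem_image]
    constructor
    · rintro ⟨i, -, rfl⟩
      exact ⟨⟨i.1, P.part.le P.mem i.2, rfl⟩,
        WithBot.coe_le_coe.2 ((atom_le _).2 i.2)⟩
    · rintro ⟨⟨i, hi, rfl⟩, hle⟩
      exact ⟨⟨i, (atom_le hi).1 (WithBot.coe_le_coe.1 hle)⟩, Finset.mem_attach _ _, rfl⟩

theorem numMaxChains_bot_top (hN : N.Nonempty) :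
    (numMaxChains (⊥ : EmbLattice N) ⊤ : ℚ) =
      (N.card.factorial : ℚ) ^ 2 / 2 ^ (N.card - 1) := by
  rw [top_eq hN, numMaxChains_bot_coe]
  simp only [whole, Finpartition.indiscrete_parts, Finset.card_singleton, Finset.prod_singleton]
  rw [← Nat.cast_mul, Nat.mul_factorial_pred (Finset.card_pos.2 hN).ne']
  ring

theorem numMaxChains_coe_top_eq_div (P : EmbeddedSubset N) {ι : Type*} [DecidableEq ι]
    {M : Finset ι} (hM : M.card = P.part.parts.card) :
    (numMaxChains (P : EmbLattice N) ⊤ : ℚ) =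
      1 / (P.part.parts.card : ℚ) * numMaxChains (⊥ : EmbLattice M) ⊤ := by
  have h := P.card_parts_pos
  rw [numMaxChains_coe_top, numMaxChains_bot_top (Finset.card_pos.1 (hM ▸ h)), hM,
    ← Nat.mul_factorial_pred h.ne']
  have : (P.part.parts.card : ℚ) ≠ 0 := Nat.cast_ne_zero.2 h.ne'
  push_cast
  field_simp

theorem card_longest_flags (hN : N.Nonempty) :
    ({F : Flag (EmbeddedSubset N) | ∀ G : Flag (EmbeddedSubset N),
      (G : Set (EmbeddedSubset N)).ncard ≤ (F : Set (EmbeddedSubset N)).ncard}.ncard : ℚ) =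
      (N.card.factorial : ℚ) ^ 2 / 2 ^ (N.card - 1) := by
  -- All maximal chains have the same length, so each is a longest one.
  have h : {F : Flag (EmbeddedSubset N) | ∀ G : Flag (EmbeddedSubset N),
      (G : Set (EmbeddedSubset N)).ncard ≤ (F : Set (EmbeddedSubset N)).ncard} = Set.univ := by
    refine Set.eq_univ_of_forall fun F G => ?_
    have h1 := Flag.ncard_add_one rank (fun _ _ => rank_covBy) F
    have h2 := Flag.ncard_add_one rank (fun _ _ => rank_covBy) G
    omega
  rw [h, Set.ncard_univ, card_flag_eq_numMaxChains, numMaxChains_bot_top hN]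

end EmbLattice

/-! ### Lower covers by splitting blocks -/

namespace EmbeddedSubset

variable {α : Type*} [DecidableEq α] {N : Finset α}

open Finpartition

/-- The part `A` of a splitting `{A, T \ A}` of a block `T` of `P`: the new distinguished block if
`T` is the distinguished block, and the part avoiding the element `x` otherwise. -/
def splittings (P : EmbeddedSubset N) (x : Finset α → α) (T : Finset α) : Finset (Finset α) :=
  if T = P.block then T.ssubsets.erase ∅ else (T.erase (x T)).powerset.erase ∅

theorem mem_splittings {P : EmbeddedSubset N} {x : Finset α → α} {T A : Finset α}
    (hx : x T ∈ T) :
    A ∈ P.splittings x T ↔ A.Nonempty ∧ A ⊂ T ∧ (T ≠ P.block → x T ∉ A) := by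
  rw [splittings, Finset.nonempty_iff_ne_empty]
  split_ifs with h
  · simp [h]
  · simp only [Finset.mem_erase, Finset.mem_powerset, Finset.subset_erase]
    refine and_congr Iff.rfl ⟨fun h1 => ⟨⟨h1.1, fun h2 => h1.2 (h2 hx)⟩, fun _ => h1.2⟩,
      fun h1 => ⟨h1.1.1, h1.2 h⟩⟩

theorem card_splittings (P : EmbeddedSubset N) {x : Finset α → α} {T : Finset α} (hx : x T ∈ T) :
    (P.splittings x T).card =
      (2 ^ (T.card - 1) - 1) + if T = P.block then 2 ^ (P.block.card - 1) - 1 else 0 := by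
  have hT : 0 < T.card := Finset.card_pos.2 ⟨_, hx⟩
  have hpow : 2 ^ T.card = 2 * 2 ^ (T.card - 1) := by
    rw [← pow_succ', Nat.sub_add_cancel hT]
  have h1 : 1 ≤ 2 ^ (T.card - 1) := Nat.one_le_two_pow
  rw [splittings]
  split_ifs with h
  · rw [Finset.card_erase_of_mem (Finset.empty_mem_ssubsets ⟨_, hx⟩), Finset.ssubsets,
      Finset.card_erase_of_mem (Finset.mem_powerset_self T), Finset.card_powerset, ← h]
    omega
  · rw [Finset.card_erase_of_mem (Finset.empty_mem_powerset _), Finset.card_powerset,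
      Finset.card_erase_of_mem hx, add_zero]

/-- The embedded subset obtained from `P` by splitting the block `T` into `A` and `T \ A`, with
distinguished block `A` if `T` is the distinguished block of `P`. -/
def splitBlock (P : EmbeddedSubset N) {T A : Finset α} (hT : T ∈ P.part.parts)
    (hA : A.Nonempty) (hAT : A ⊂ T) : EmbeddedSubset N where
  block := if T = P.block then A else P.block
  part := P.part.split hT hA hAT
  mem := by
    rw [split_parts]
    split_ifs with h
    · simp
    · exact Finset.mem_insert_of_mem (Finset.mem_insert_of_mem
        (Finset.mem_erase.2 ⟨Ne.symm h, P.mem⟩))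

theorem splitBlock_covBy (P : EmbeddedSubset N) {T A : Finset α} (hT : T ∈ P.part.parts)
    (hA : A.Nonempty) (hAT : A ⊂ T) : P.splitBlock hT hA hAT ⋖ P := by
  refine covBy_of_card ⟨?_, split_le hT hA hAT⟩ (card_split hT hA hAT)
  simp only [splitBlock]
  split_ifs with h
  · exact h ▸ hAT.1
  · exact subset_rfl

/-- The new blocks of the partition are `A` and `T \ A`, which recovers `T`. Between the halves, `A`
is singled out as the distinguished block, or as the half avoiding `x T`. -/
theorem splitBlock_inj {P : EmbeddedSubset N} {x : Finset α → α} {T A T' A' : Finset α}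
    (hx : x T ∈ T) (hT : T ∈ P.part.parts) (hA : A.Nonempty) (hAT : A ⊂ T)
    (hT' : T' ∈ P.part.parts) (hA' : A'.Nonempty) (hAT' : A' ⊂ T')
    (hxA : T ≠ P.block → x T ∉ A) (hxA' : T' ≠ P.block → x T' ∉ A')
    (h : P.splitBlock hT hA hAT = P.splitBlock hT' hA' hAT') : T = T' ∧ A = A' := by
  have h1 : ({A, T \ A} : Finset (Finset α)) = {A', T' \ A'} := by
    rw [← split_parts_sdiff hT hA hAT, ← split_parts_sdiff hT' hA' hAT']
    exact congrArg (fun Q => Q.part.parts \ P.part.parts) h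
  have h2 : A ∈ ({A', T' \ A'} : Finset (Finset α)) := h1 ▸ Finset.mem_insert_self _ _
  rw [Finset.mem_insert, Finset.mem_singleton] at h2
  have hTT : T = T' := by
    obtain ⟨y, hy⟩ := id hA
    refine P.part.eq_of_mem_parts hT hT' (hAT.1 hy) ?_
    rcases h2 with rfl | h2
    · exact hAT'.1 hy
    · rw [h2] at hy
      exact (Finset.mem_sdiff.1 hy).1
  subst hTT
  refine ⟨rfl, ?_⟩
  by_cases hTP : T = P.block
  · have h3 := congrArg EmbeddedSubset.block h
    simpa [splitBlock, hTP] using h3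
  · refine h2.resolve_right fun h3 => hxA hTP ?_
    rw [h3, Finset.mem_sdiff]
    exact ⟨hx, hxA' hTP⟩

theorem exists_splitBlock_eq {P Q : EmbeddedSubset N} (h : Q ⋖ P) (x : Finset α → α) :
    ∃ (T A : Finset α) (hT : T ∈ P.part.parts) (hA : A.Nonempty) (hAT : A ⊂ T),
      (T ≠ P.block → x T ∉ A) ∧ P.splitBlock hT hA hAT = Q := by
  obtain ⟨A, B, hA, hB, hAB, hP⟩ := exists_part_eq_merge h
  obtain ⟨hAT, hsplit⟩ := eq_split_merge hA hB hAB
  have hA0 := Q.part.nonempty_of_mem_parts hA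
  have hdisj : Disjoint A B := Q.part.disjoint hA hB hAB
  -- The roles of `A` and `B` are symmetric: `C` is the half equal to `Q.block` when the
  -- distinguished block is split, and otherwise the half avoiding the marked point.
  have hcond : ∃ (C : Finset α) (hC : C.Nonempty) (hCT : C ⊂ A ∪ B)
      (hT : A ∪ B ∈ P.part.parts), (A ∪ B = P.block → C = Q.block) ∧
      (A ∪ B ≠ P.block → x (A ∪ B) ∉ C) ∧ P.part.split hT hC hCT = Q.part := by
    have hT : A ∪ B ∈ P.part.parts := hP ▸ union_mem_merge hA hB
    have hsA : P.part.split hT hA0 hAT = Q.part := by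
      refine Finpartition.ext ?_
      rw [split_parts, hP]
      exact (congrArg Finpartition.parts hsplit).symm
    have hsd : (A ∪ B) \ A = B := by
      rw [Finset.union_sdiff_left, Finset.sdiff_eq_self_of_disjoint hdisj.symm]
    have hsd' : (A ∪ B) \ B = A := by
      rw [Finset.union_sdiff_right, Finset.sdiff_eq_self_of_disjoint hdisj]
    have hB0 := Q.part.nonempty_of_mem_parts hB
    have hBT : B ⊂ A ∪ B := by
      have h1 := sdiff_ssubset_of_ssubset hA0 hAT
      rwa [hsd] at h1
    have hsB : P.part.split hT hB0 hBT = Q.part := by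
      rw [← hsA]
      refine Finpartition.ext ?_
      rw [split_parts, split_parts, hsd, hsd', Finset.insert_comm]
    by_cases hTP : A ∪ B = P.block
    · have hQ := Q.mem
      have hQb : Q.block = A ∨ Q.block = B := by
        rw [← hsA, split_parts, hsd, Finset.mem_insert, Finset.mem_insert, Finset.mem_erase] at hQ
        rcases hQ with hQ | hQ | ⟨hne, hQ⟩
        · exact Or.inl hQ
        · exact Or.inr hQ
        · obtain ⟨y, hy⟩ := Q.block_nonempty
          exact absurd (P.part.eq_of_mem_parts hQ hT hy (hTP ▸ h.le.1 hy)) hne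
      rcases hQb with hQb | hQb
      · exact ⟨A, hA0, hAT, hT, fun _ => hQb.symm, fun h => absurd hTP h, hsA⟩
      · exact ⟨B, hB0, hBT, hT, fun _ => hQb.symm, fun h => absurd hTP h, hsB⟩
    · by_cases hxA : x (A ∪ B) ∈ A
      · exact ⟨B, hB0, hBT, hT, fun h => absurd h hTP,
          fun _ => Finset.disjoint_left.1 hdisj hxA, hsB⟩
      · exact ⟨A, hA0, hAT, hT, fun h => absurd h hTP, fun _ => hxA, hsA⟩
  obtain ⟨C, hC, hCT, hT, h1, h2, h3⟩ := hcond
  refine ⟨A ∪ B, C, hT, hC, hCT, h2, EmbeddedSubset.ext ?_ h3⟩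
  simp only [splitBlock]
  split_ifs with hTP
  · exact h1 hTP
  · have hQ := Q.mem
    rw [← h3, split_parts, Finset.mem_insert, Finset.mem_insert, Finset.mem_erase] at hQ
    obtain ⟨y, hy⟩ := Q.block_nonempty
    have hyP := h.le.1 hy
    have hyT : y ∉ A ∪ B := fun hyT => hTP (P.part.eq_of_mem_parts hT P.mem hyT hyP)
    rcases hQ with hQ | hQ | hQ
    · exact absurd (hCT.1 (hQ ▸ hy)) hyT
    · rw [hQ] at hy
      exact absurd (Finset.mem_sdiff.1 hy).1 hyT
    · exact P.part.eq_of_mem_parts P.mem hQ.2 hyP hy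

/-- A block of size `t` has `2 ^ (t - 1) - 1` unordered splittings. For the distinguished block the
halves are ordered by which one is kept, so its term occurs a second time. -/
theorem ncard_setOf_covBy (P : EmbeddedSubset N) :
    {Q | Q ⋖ P}.ncard =
      ∑ T ∈ P.part.parts, (2 ^ (T.card - 1) - 1) + (2 ^ (P.block.card - 1) - 1) := by
  classical
  have hch : ∀ T : Finset α, ∃ y, T ∈ P.part.parts → y ∈ T := fun T => by
    by_cases hT : T ∈ P.part.parts
    · obtain ⟨y, hy⟩ := P.part.nonempty_of_mem_parts hT
      exact ⟨y, fun _ => hy⟩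
    · obtain ⟨y, -⟩ := P.block_nonempty
      exact ⟨y, fun h => absurd h hT⟩
  choose x hx using hch
  have hcard : (P.part.parts.sigma (P.splittings x)).card =
      ∑ T ∈ P.part.parts, (2 ^ (T.card - 1) - 1) + (2 ^ (P.block.card - 1) - 1) := by
    rw [Finset.card_sigma, Finset.sum_congr rfl fun T hT => card_splittings P (hx T hT),
      Finset.sum_add_distrib, Finset.sum_ite_eq' P.part.parts P.block, if_pos P.mem]
  have hsig : ∀ p ∈ P.part.parts.sigma (P.splittings x), p.1 ∈ P.part.parts ∧ p.2.Nonempty ∧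
      p.2 ⊂ p.1 ∧ (p.1 ≠ P.block → x p.1 ∉ p.2) := by
    intro p hp
    obtain ⟨h1, h2⟩ := Finset.mem_sigma.1 hp
    exact ⟨h1, (mem_splittings (hx _ h1)).1 h2⟩
  rw [← hcard, Set.ncard_eq_toFinset_card _ (Set.toFinite _)]
  symm
  refine Finset.card_bij (fun p hp =>
    P.splitBlock (hsig p hp).1 (hsig p hp).2.1 (hsig p hp).2.2.1) ?_ ?_ ?_
  · intro p hp
    rw [Set.Finite.mem_toFinset]
    exact splitBlock_covBy P _ _ _
  · intro p hp q hq h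
    obtain ⟨h1, h2⟩ := splitBlock_inj (hx _ (hsig p hp).1) _ _ _ _ _ _
      (hsig p hp).2.2.2 (hsig q hq).2.2.2 h
    exact Sigma.ext h1 (heq_of_eq h2)
  · intro Q hQ
    rw [Set.Finite.mem_toFinset] at hQ
    obtain ⟨T, A, hT, hA, hAT, h1, h2⟩ := exists_splitBlock_eq hQ x
    exact ⟨⟨T, A⟩, Finset.mem_sigma.2 ⟨hT, (mem_splittings (hx T hT)).2 ⟨hA, hAT, h1⟩⟩, h2⟩

theorem isMin_iff_card {P : EmbeddedSubset N} : IsMin P ↔ P.part.parts.card = N.card := by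
  refine ⟨EmbLattice.card_of_isMin, fun h Q hQ => ?_⟩
  have h1 := Q.part.card_parts_le_card
  have h2 := Finpartition.card_mono hQ.2
  rcases hQ.eq_or_lt with rfl | h3
  · exact le_rfl
  · have := card_lt_of_lt h3
    omega

end EmbeddedSubset

/-! ### Lower covers in the lattice and the irreducible elements -/

namespace EmbLattice

variable {α : Type*} [DecidableEq α] {N : Finset α}

open EmbeddedSubset

theorem setOf_covBy_eq_singleton_bot {P : EmbeddedSubset N} (h : P.part.parts.card = N.card) :
    {x : EmbLattice N | x ⋖ (P : EmbLattice N)} = {⊥} := by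
  have hP := isMin_iff_card.2 h
  ext x
  induction x using WithBot.recBotCoe with
  | bot => exact iff_of_true (WithBot.bot_covBy_coe.2 hP) rfl
  | coe Q =>
    simp only [Set.mem_ofPred_eq, WithBot.coe_covBy_coe, Set.mem_singleton_iff,
      WithBot.coe_ne_bot, iff_false]
    exact fun hQ => hP.not_lt hQ.lt

theorem ncard_setOf_covBy {P : EmbeddedSubset N} (h : P.part.parts.card < N.card) :
    {x : EmbLattice N | x ⋖ (P : EmbLattice N)}.ncard =
      ∑ T ∈ P.part.parts, (2 ^ (T.card - 1) - 1) + (2 ^ (P.block.card - 1) - 1) := by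
  rw [← EmbeddedSubset.ncard_setOf_covBy,
    ← Set.ncard_image_of_injective _ (WithBot.coe_injective (α := EmbeddedSubset N))]
  congr 1
  ext x
  induction x using WithBot.recBotCoe with
  | bot =>
    refine iff_of_false (fun h1 => h.ne (isMin_iff_card.1 (WithBot.bot_covBy_coe.1 h1))) ?_
    simp
  | coe Q => simp [WithBot.coe_covBy_coe]

theorem ncard_setOf_covBy_cast {P : EmbeddedSubset N} (h : P.part.parts.card < N.card) :
    (({x : EmbLattice N | x ⋖ (P : EmbLattice N)}.ncard : ℕ) : ℤ) =
      ∑ T ∈ P.part.parts, (2 : ℤ) ^ (T.card - 1) - P.part.parts.card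
        + 2 ^ (P.block.card - 1) - 1 := by
  have h1 : ∀ m : ℕ, ((2 ^ m - 1 : ℕ) : ℤ) = 2 ^ m - 1 := fun m => by
    rw [Nat.cast_sub Nat.one_le_two_pow]
    push_cast
    rfl
  rw [ncard_setOf_covBy h, Nat.cast_add, Nat.cast_sum, h1,
    Finset.sum_congr rfl fun T _ => h1 (T.card - 1), Finset.sum_sub_distrib]
  simp only [Finset.sum_const, nsmul_eq_mul, mul_one]
  ring

theorem supIrred_coe_singletonPair {i j k : α} (hi : i ∈ N) (hj : j ∈ N) (hk : k ∈ N)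
    (h : i ∉ ({j, k} : Finset α)) (hjk : j ≠ k) :
    SupIrred ((singletonPair hi hj hk h : EmbeddedSubset N) : EmbLattice N) := by
  have hcov := atom_covBy_singletonPair hi hj hk h hjk
  have hcard := card_of_covBy hcov
  rw [supIrred_iff_ncard_covBy_eq_one, Set.ncard_eq_one]
  refine ⟨((atom i hi : EmbeddedSubset N) : EmbLattice N),
    Set.eq_singleton_iff_unique_mem.2 ⟨WithBot.coe_covBy_coe.2 hcov, fun x hx => ?_⟩⟩
  have hx' : x ⋖ ((singletonPair hi hj hk h : EmbeddedSubset N) : EmbLattice N) := hx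
  induction x using WithBot.recBotCoe with
  | bot =>
    have h1 := isMin_iff_card.1 (WithBot.bot_covBy_coe.1 hx')
    have h2 : (atom i hi).part.parts.card = N.card := Finpartition.card_bot N
    omega
  | coe Q =>
    have h1 := WithBot.coe_covBy_coe.1 hx'
    have h2 := card_of_covBy h1
    have h3 : IsMin Q := isMin_iff_card.2 (by
      rw [h2, ← hcard]
      exact Finpartition.card_bot N)
    obtain ⟨i', hi', rfl⟩ := isMin_iff.1 h3
    have h4 := (atom_le hi').1 h1.le
    obtain rfl : i' = i := by simpa [singletonPair] using h4
    rfl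

/-- The number of lower covers is one. The distinguished block is counted twice, so its term
vanishes and it is a singleton; the other terms add up to one, so exactly one block has two elements
and the rest are singletons. -/
theorem exists_eq_singletonPair {P : EmbeddedSubset N} (h : SupIrred (P : EmbLattice N))
    (hP : P.part.parts.card < N.card) :
    ∃ (i j k : α) (hi : i ∈ N) (hj : j ∈ N) (hk : k ∈ N) (hijk : i ∉ ({j, k} : Finset α)),
      j ≠ k ∧ P = singletonPair hi hj hk hijk := by
  rw [supIrred_iff_ncard_covBy_eq_one, ncard_setOf_covBy hP] at h
  have hle := Finset.single_le_sum (f := fun T : Finset α => 2 ^ (T.card - 1) - 1)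
    (fun _ _ => Nat.zero_le _) P.mem
  have hpow : ∀ T : Finset α, 2 ^ (T.card - 1) - 1 = 0 → T.card ≤ 1 := fun T hT => by
    by_contra hc
    have : 2 ^ 1 ≤ 2 ^ (T.card - 1) := Nat.pow_le_pow_right (by norm_num) (by omega)
    omega
  have hS : P.block.card = 1 := by
    have h1 := hpow P.block (by omega)
    have h2 := Finset.card_pos.2 P.block_nonempty
    omega
  have hsum : ∑ T ∈ P.part.parts, (2 ^ (T.card - 1) - 1) = 1 := by
    rw [hS] at h
    simpa using h
  obtain ⟨T, hT, hT0⟩ : ∃ T ∈ P.part.parts, 2 ^ (T.card - 1) - 1 ≠ 0 :=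
    Finset.exists_ne_zero_of_sum_ne_zero (by rw [hsum]; exact one_ne_zero)
  have hrest := Finset.add_sum_erase _ (fun T : Finset α => 2 ^ (T.card - 1) - 1) hT
  rw [hsum] at hrest
  have hothers : ∀ B ∈ P.part.parts, B ≠ T → B.card ≤ 1 := fun B hB hBT => by
    refine hpow B ?_
    have := Finset.single_le_sum (f := fun T : Finset α => 2 ^ (T.card - 1) - 1)
      (fun _ _ => Nat.zero_le _) (Finset.mem_erase.2 ⟨hBT, hB⟩)
    omega
  have hT2 : T.card = 2 := by
    have h1 : 2 ^ (T.card - 1) = 2 := by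
      omega
    have h2 : T.card - 1 = 1 := Nat.pow_right_injective le_rfl (h1.trans (pow_one 2).symm)
    omega
  obtain ⟨j, k, hjk, rfl⟩ := Finset.card_eq_two.1 hT2
  obtain ⟨i, hi⟩ := Finset.card_eq_one.1 hS
  have hjN : j ∈ N := P.part.le hT (by simp)
  have hkN : k ∈ N := P.part.le hT (by simp)
  have hiN : i ∈ N := P.part.le P.mem (by simp [hi])
  have hne : P.block ≠ {j, k} := fun h1 => by
    rw [h1, hT2] at hS
    omega
  have hijk : i ∉ ({j, k} : Finset α) := fun h1 =>
    hne (P.part.eq_of_mem_parts P.mem hT (by simp [hi]) h1)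
  refine ⟨i, j, k, hiN, hjN, hkN, hijk, hjk, EmbeddedSubset.ext hi (le_antisymm ?_ ?_)⟩
  · intro B hB
    by_cases hBT : B = {j, k}
    · subst hBT
      exact ⟨{j} ∪ {k}, Finset.mem_insert_self _ _, le_rfl⟩
    · obtain ⟨x, hx⟩ := P.part.nonempty_of_mem_parts hB
      obtain ⟨C, hC, hxC⟩ := (singletonPair hiN hjN hkN hijk).part.exists_mem (P.part.le hB hx)
      refine ⟨C, hC, fun y hy => ?_⟩
      rwa [Finset.card_le_one.1 (hothers B hB hBT) y hy x hx]
  · exact (Finpartition.merge_le_iff (Finpartition.mem_bot_iff.2 ⟨j, hjN, rfl⟩)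
      (Finpartition.mem_bot_iff.2 ⟨k, hkN, rfl⟩)).2 ⟨bot_le, {j, k}, hT, subset_rfl⟩

theorem supIrred_iff {x : EmbLattice N} :
    SupIrred x ↔ (∃ i, ∃ hi : i ∈ N, x = ((atom i hi : EmbeddedSubset N) : EmbLattice N)) ∨
      ∃ (i j k : α) (hi : i ∈ N) (hj : j ∈ N) (hk : k ∈ N) (h : i ∉ ({j, k} : Finset α)),
        j ≠ k ∧ x = ((singletonPair hi hj hk h : EmbeddedSubset N) : EmbLattice N) := by
  constructor
  · intro h
    induction x using WithBot.recBotCoe with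
    | bot => exact absurd h not_supIrred_bot
    | coe P =>
      rcases P.part.card_parts_le_card.eq_or_lt with h1 | h1
      · obtain ⟨i, hi, rfl⟩ := isMin_iff.1 (isMin_iff_card.2 h1)
        exact Or.inl ⟨i, hi, rfl⟩
      · obtain ⟨i, j, k, hi, hj, hk, hijk, hjk, rfl⟩ := exists_eq_singletonPair h h1
        exact Or.inr ⟨i, j, k, hi, hj, hk, hijk, hjk, rfl⟩
  · rintro (⟨i, hi, rfl⟩ | ⟨i, j, k, hi, hj, hk, h, hjk, rfl⟩)
    · rw [supIrred_iff_ncard_covBy_eq_one,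
        setOf_covBy_eq_singleton_bot (card_of_isMin (isMin_atom hi)), Set.ncard_singleton]
    · exact supIrred_coe_singletonPair hi hj hk h hjk

/-- `k.choose 2 = 1` only for `k = 2`. The element `⊥` is excluded because it has at least two atoms
above it. -/
theorem infIrred_iff (hN : 2 ≤ N.card) {x : EmbLattice N} :
    InfIrred x ↔ ∃ P : EmbeddedSubset N, x = P ∧ P.part.parts.card = 2 := by
  rw [infIrred_iff_ncard_covBy_eq_one]
  induction x using WithBot.recBotCoe with
  | bot =>
    simp only [WithBot.bot_ne_coe, false_and, exists_false, iff_false]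
    obtain ⟨i, hi, j, hj, hij⟩ := Finset.one_lt_card.1 (by omega : 1 < N.card)
    intro h
    obtain ⟨c, hc⟩ := Set.ncard_eq_one.1 h
    have hmem : ∀ i (hi : i ∈ N), ((atom i hi : EmbeddedSubset N) : EmbLattice N) = c :=
      fun i hi => hc.le (bot_covBy_iff.2 (isAtom_iff.2 ⟨i, hi, rfl⟩))
    have h1 := WithBot.coe_inj.1 ((hmem i hi).trans (hmem j hj).symm)
    exact hij (Finset.singleton_injective (congrArg EmbeddedSubset.block h1))
  | coe P =>
    rw [ncard_covBy]
    simp only [WithBot.coe_inj, exists_eq_left']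
    constructor
    · intro h
      rcases Nat.lt_or_ge P.part.parts.card 2 with h1 | h1
      · rw [Nat.choose_eq_zero_of_lt h1] at h
        exact absurd h zero_ne_one
      · rcases h1.eq_or_lt with h2 | h2
        · exact h2.symm
        · have h3 : Nat.choose 3 2 ≤ P.part.parts.card.choose 2 := Nat.choose_le_choose 2 h2
          rw [h] at h3
          exact absurd h3 (by decide)
    · intro h
      rw [h]
      rfl

end EmbLattice

/-! ### Assembly and numerical tables -/

theorem proposition3 :
    (∀ n : ℕ, 2 < n →
      -- the ordered set is a lattice
      (∀ x y : EmbBot n, (∃ z, IsLUB {x, y} z) ∧ (∃ z, IsGLB {x, y} z)) ∧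
      -- (i) supremum: `T`, `T'` are the blocks of `σ = π ∨ π'` containing `S`, `S'`
      (∀ P P' : Emb n, ∃ σ : SetPartition n, IsLUB {P.part, P'.part} σ ∧
        ∃ T ∈ σ.parts, ∃ T' ∈ σ.parts, P.block ⊆ T ∧ P'.block ⊆ T' ∧
          ∃ R : Emb n, R.block = T ∪ T' ∧
            R.part.parts = insert (T ∪ T') ((σ.parts.erase T).erase T') ∧
            (P : EmbBot n) ⊔ P' = R) ∧
      -- (i) infimum
      (∀ P P' : Emb n, (P.block ∩ P'.block).Nonempty →
        ∃ R : Emb n, R.block = P.block ∩ P'.block ∧ R.part = P.part ⊓ P'.part ∧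
          (P : EmbBot n) ⊓ P' = R) ∧
      (∀ P P' : Emb n, P.block ∩ P'.block = ∅ → (P : EmbBot n) ⊓ P' = ⊥) ∧
      -- (ii) top, bottom, complements
      (∃ R : Emb n, R.block = Finset.univ ∧ R.part.parts = {Finset.univ} ∧
        IsTop (R : EmbBot n) ∧ (R : EmbBot n) = ⊤) ∧
      IsBot (⊥ : EmbBot n) ∧
      ComplementedLattice (EmbBot n) ∧
      (∀ P Q : Emb n, Q.block = P.blockᶜ → IsCompl (P : EmbBot n) Q) ∧
      -- (iii) coverings
      (∀ P : Emb n, {x : EmbBot n | (P : EmbBot n) ⋖ x}.ncard = P.part.parts.card.choose 2) ∧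
      (∀ P : Emb n, P.part.parts.card < n →
        (({x : EmbBot n | x ⋖ (P : EmbBot n)}.ncard : ℕ) : ℤ) =
          ∑ T ∈ P.part.parts, (2 : ℤ) ^ (T.card - 1) - P.part.parts.card
            + 2 ^ (P.block.card - 1) - 1) ∧
      (∀ P : Emb n, P.part.parts.card = n → {x : EmbBot n | x ⋖ (P : EmbBot n)} = {⊥}) ∧
      -- (iv) irreducible elements, atoms, co-atoms
      (∀ x : EmbBot n, IsAtom x ↔ ∃ i : Fin n, x = (Emb.atom i : Emb n)) ∧
      (∀ x : EmbBot n, SupIrred x ↔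
        (∃ i : Fin n, x = (Emb.atom i : Emb n)) ∨
        (∃ i j k : Fin n, j ≠ k ∧ i ∉ ({j, k} : Finset (Fin n)) ∧ ∃ P : Emb n,
          x = P ∧ P.block = {i} ∧
          P.part.parts = insert {j, k} (({j, k} : Finset (Fin n))ᶜ.image fun a => {a}))) ∧
      (∀ x : EmbBot n, IsCoatom x ↔ ∃ P : Emb n, x = P ∧ P.part.parts.card = 2) ∧
      (∀ x : EmbBot n, InfIrred x ↔ ∃ P : Emb n, x = P ∧ P.part.parts.card = 2) ∧
      -- (v) chain condition and height function
      JordanDedekind (EmbBot n) ∧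
      (∀ x y : EmbBot n, x ⋖ y → Order.height y = Order.height x + 1) ∧
      Order.height (⊥ : EmbBot n) = 0 ∧
      (∀ P : Emb n, Order.height (P : EmbBot n) = ((n - P.part.parts.card + 1 : ℕ) : ℕ∞)) ∧
      Order.krullDim (EmbBot n) = n ∧
      -- (vi) distributivity, atomisticity, modularity
      ¬ IsDistribLattice (EmbBot n) ∧
      ¬ IsUpperLocallyDistrib (EmbBot n) ∧
      ¬ IsLowerLocallyDistrib (EmbBot n) ∧
      ¬ IsAtomistic (EmbBot n) ∧
      ¬ IsGeometricLattice (EmbBot n) ∧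
      ¬ IsModularLattice (EmbBot n) ∧
      IsUpperModularLattice (EmbBot n) ∧
      -- (vii) number of elements
      (∀ k ∈ Finset.Icc 1 n,
        {x : EmbBot n | Order.height x = ((n - k + 1 : ℕ) : ℕ∞)}.ncard
          = k * Nat.stirlingSecond n k) ∧
      Nat.card (EmbBot n) = ∑ k ∈ Finset.Icc 1 n, k * Nat.stirlingSecond n k + 1 ∧
      -- (viii) isomorphisms
      (∀ i : Fin n, Nonempty (Set.Icc ((Emb.atom i : Emb n) : EmbBot n) ⊤ ≃o SetPartition n)) ∧
      (∀ P : Emb n, Nonempty (Set.Icc (⊥ : EmbBot n) P ≃o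
        WithBot (EmbeddedSubset P.block ×
          ((T : {T : Finset (Fin n) // T ∈ P.part.parts.erase P.block}) →
            Finpartition T.1)))) ∧
      (∀ P : Emb n, ∀ i : Fin P.part.parts.card,
        Nonempty (Set.Icc (P : EmbBot n) ⊤ ≃o
          Set.Icc ((Emb.atom i : Emb P.part.parts.card) : EmbBot P.part.parts.card) ⊤)) ∧
      (∀ P : Emb n, Nonempty (Set.Icc (P : EmbBot n) ⊤ ≃o SetPartition P.part.parts.card)) ∧
      (∀ P' P : Emb n, P' ≤ P →
        ∀ e : Fin P'.part.parts.card ≃ {T : Finset (Fin n) // T ∈ P'.part.parts},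
          ∃ Q : Emb P'.part.parts.card,
            Q.block = Finset.univ.filter (fun j => (e j).1 ⊆ P.block) ∧
            Q.part.parts =
              P.part.parts.image (fun T => Finset.univ.filter (fun j => (e j).1 ⊆ T)) ∧
            Nonempty (Set.Icc (P' : EmbBot n) P ≃o
              Set.Icc ((Emb.atom (e.symm ⟨P'.block, P'.mem⟩) : Emb P'.part.parts.card) :
                EmbBot P'.part.parts.card) Q)) ∧
      -- (ix) maximal chains from bottom to top, and longest maximal chains without bottom
      (numMaxChains (⊥ : EmbBot n) ⊤ : ℚ) = (n.factorial : ℚ) ^ 2 / 2 ^ (n - 1) ∧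
      (({F : Flag (Emb n) | ∀ G : Flag (Emb n),
          (G : Set (Emb n)).ncard ≤ (F : Set (Emb n)).ncard}.ncard : ℕ) : ℚ)
        = (n.factorial : ℚ) ^ 2 / 2 ^ (n - 1) ∧
      -- (x) maximal chains from bottom to an element, and from an element to the top
      (∀ P : Emb n, (numMaxChains (⊥ : EmbBot n) P : ℚ) =
        (P.block.card : ℚ) * (n - P.part.parts.card).factorial / 2 ^ (n - P.part.parts.card)
          * ∏ T ∈ P.part.parts, (T.card.factorial : ℚ)) ∧
      (∀ P : Emb n, (numMaxChains (P : EmbBot n) ⊤ : ℚ) =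
        1 / (P.part.parts.card : ℚ) *
          numMaxChains (⊥ : EmbBot P.part.parts.card) ⊤) ∧
      (∀ P : Emb n, (numMaxChains (P : EmbBot n) ⊤ : ℚ) =
        (P.part.parts.card.factorial : ℚ) * (P.part.parts.card - 1).factorial
          / 2 ^ (P.part.parts.card - 1)) ∧
      -- (xi) maximal chains between two embedded subsets
      (∀ P' P : Emb n, P' ≤ P → (numMaxChains (P' : EmbBot n) P : ℚ) =
        ((P'.part.parts.card - P.part.parts.card).factorial : ℚ)
            / 2 ^ (P'.part.parts.card - P.part.parts.card)
          * ∏ T ∈ P.part.parts, ((P'.part.parts.filter (fun T' => T' ⊆ T)).card.factorial : ℚ))) ∧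
    -- the tabulated numbers of elements
    (∀ p ∈ [(1, 2), (2, 4), (3, 11), (4, 38), (5, 152), (6, 675), (7, 3264), (8, 17008)],
      Nat.card (EmbBot p.1) = p.2) ∧
    -- the tabulated numbers of maximal chains
    (∀ p ∈ [(1, 1), (2, 2), (3, 9), (4, 72), (5, 900), (6, 16200), (7, 396900), (8, 12700800)],
      numMaxChains (⊥ : EmbBot p.1) ⊤ = p.2) := by
  refine ⟨fun n hn => ?_, ?_, ?_⟩
  · have hcard : (Finset.univ : Finset (Fin n)).card = n := Finset.card_fin n
    have hne : (Finset.univ : Finset (Fin n)).Nonempty := Finset.card_pos.1 (by omega)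
    have h3 : 2 < (Finset.univ : Finset (Fin n)).card := by omega
    refine ⟨fun x y => ⟨⟨_, isLUB_pair⟩, ⟨_, isGLB_pair⟩⟩, EmbLattice.exists_sup_eq,
      fun P P' h => ⟨P.inter P' h, rfl, rfl, EmbLattice.inf_coe_of_nonempty h⟩,
      fun P P' h => EmbLattice.inf_coe_of_eq_empty h,
      ⟨EmbeddedSubset.whole hne, rfl, rfl, ?_, (EmbLattice.top_eq hne).symm⟩, isBot_bot,
      EmbLattice.complementedLattice,
      fun P Q h => EmbLattice.isCompl_of_block_eq (h.trans (Finset.compl_eq_univ_sdiff _)),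
      EmbLattice.ncard_covBy,
      fun P h => EmbLattice.ncard_setOf_covBy_cast (by rwa [hcard]),
      fun P h => EmbLattice.setOf_covBy_eq_singleton_bot (by rwa [hcard]),
      fun x => ?_, fun x => ?_, fun x => EmbLattice.isCoatom_iff h3.le,
      fun x => EmbLattice.infIrred_iff h3.le, EmbLattice.jordanDedekind, ?_, Order.height_bot _,
      ?_, ?_, EmbLattice.not_isDistribLattice h3, EmbLattice.not_isUpperLocallyDistrib h3,
      EmbLattice.not_isLowerLocallyDistrib h3, EmbLattice.not_isAtomistic h3,
      fun h => EmbLattice.not_isAtomistic h3 h.2.2, EmbLattice.not_isModularLattice h3,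
      EmbLattice.isUpperModularLattice, ?_, ?_,
      fun i => EmbLattice.nonempty_Icc_atom_top_orderIso (Finset.mem_univ i),
      EmbLattice.nonempty_Icc_bot_orderIso, fun P i => ?_,
      fun P => EmbLattice.nonempty_Icc_top_orderIso_finpartition P P.part.parts.equivFin.symm,
      fun P' P h e => ⟨EmbeddedSubset.labelled e P h, rfl, rfl, EmbLattice.nonempty_Icc_orderIso_labelled e h⟩,
      ?_, ?_, fun P => ?_, ?_, EmbLattice.numMaxChains_coe_top,
      fun P' P h => EmbLattice.numMaxChains_coe_coe h⟩
    · rw [← EmbLattice.top_eq hne]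
      exact isTop_top
    · simp [EmbLattice.isAtom_iff]
    · rw [EmbLattice.supIrred_iff]
      refine or_congr (by simp) ⟨?_, ?_⟩
      · rintro ⟨i, j, k, hi, hj, hk, h, hjk, rfl⟩
        refine ⟨i, j, k, hjk, h, _, rfl, rfl, ?_⟩
        rw [EmbeddedSubset.singletonPair_parts, Finset.compl_eq_univ_sdiff]
      · rintro ⟨i, j, k, hjk, h, P, rfl, hP, hparts⟩
        refine ⟨i, j, k, Finset.mem_univ i, Finset.mem_univ j, Finset.mem_univ k, h, hjk, ?_⟩
        refine congrArg _ (EmbeddedSubset.ext hP (Finpartition.ext ?_))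
        rw [hparts, EmbeddedSubset.singletonPair_parts, Finset.compl_eq_univ_sdiff]
    · intro x y hxy
      rw [EmbLattice.height_eq_rank, EmbLattice.height_eq_rank, EmbLattice.rank_covBy hxy]
      rfl
    · intro P
      rw [EmbLattice.height_eq_rank, EmbLattice.rank_coe, hcard]
    · rw [EmbLattice.krullDim_eq hne, hcard]
    · intro k hk
      have h := EmbLattice.ncard_height_eq (N := (Finset.univ : Finset (Fin n))) (k := k)
        (by rwa [hcard])
      rwa [hcard] at h
    · rw [EmbLattice.card_eq, hcard]
    -- Both intervals are isomorphic to the lattice of partitions of the set of labels.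
    · obtain ⟨f⟩ := EmbLattice.nonempty_Icc_top_orderIso_finpartition P
        P.part.parts.equivFin.symm
      obtain ⟨g⟩ := EmbLattice.nonempty_Icc_atom_top_orderIso (Finset.mem_univ i)
      exact ⟨f.trans g.symm⟩
    · rw [EmbLattice.numMaxChains_bot_top hne, hcard]
    · rw [EmbLattice.card_longest_flags hne, hcard]
    · rw [EmbLattice.numMaxChains_bot_coe, hcard]
    · exact fun P => EmbLattice.numMaxChains_coe_top_eq_div P (Finset.card_fin _)
  · intro p hp
    rw [EmbLattice.card_eq, Finset.card_fin]
    revert p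
    decide
  -- Clearing the denominator turns each table entry into a decidable identity of natural numbers.
  · have h : ∀ n m : ℕ, 0 < n → (n.factorial ^ 2 = m * 2 ^ (n - 1)) →
        numMaxChains (⊥ : EmbBot n) ⊤ = m := by
      intro n m hn hm
      have h1 := EmbLattice.numMaxChains_bot_top (N := (Finset.univ : Finset (Fin n)))
        (Finset.card_pos.1 (by rwa [Finset.card_fin]))
      rw [Finset.card_fin, ← Nat.cast_pow, hm] at h1
      have h2 : (numMaxChains (⊥ : EmbBot n) ⊤ : ℚ) = m := by
        rw [h1]
        push_cast
        field_simp
      exact_mod_cast h2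
    have hlist : ∀ p ∈ [(1, 1), (2, 2), (3, 9), (4, 72), (5, 900), (6, 16200), (7, 396900),
        (8, 12700800)], 0 < p.1 ∧ p.1.factorial ^ 2 = p.2 * 2 ^ (p.1 - 1) := by
      decide
    exact fun p hp => h p.1 p.2 (hlist p hp).1 (hlist p hp).2
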